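/- **Setting.** Let $\mathbf{Var}$ and $\mathbf{LockName}$ be sets (of variables and of resources), $\mathbf{Val}=\mathbb Z$, $\mathbf{Loc}=\mathbb N\subseteq\mathbf{Val}$. A memory state $\mu=(s,h)$ is a pair of finite partial functions $s:\mathbf{Var}\rightharpoonup\mathbf{Val}$, $h:\mathbf{Loc}\rightharpoonup\mathbf{Val}$; a machine state is a pair $(\mu,L)$ with $L\subseteq\mathbf{LockName}$ the set of locked resources. The instructions are $x:=E$, $x:=[E]$, $[E]:=E'$, $\mathsf{nop}$, $x:=\mathsf{alloc}(E)$, $\mathsf{dispose}(E)$, $P(r)$, $V(r)$, with their usual effect on machine states. An instruction other than $P(r)$ which cannot execute successfully (an expression reads an unallocated variable, an address is not allocated, $V(r)$ is applied to an unlocked resource) produces a runtime error; $P(r)$ waits while $r$ is locked. **Traces.** A trace is a sequence $\mathfrak s_1\xrightarrow{env}\mathfrak s_2\xrightarrow{m_1}\mathfrak s_3\xrightarrow{env}\cdots\xrightarrow{m_p}\mathfrak s_{2p+1}\xrightarrow{env}\mathfrak s_{2p+2}$ whose Environment transitions are arbitrary and whose Code transitions are machine steps, successful or erroneous. A command $C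 ::= x:=E \mid x:=[E] \mid [E]:=E' \mid x:=\mathsf{alloc}(E)\mid \mathsf{dispose}(E)\mid \mathsf{skip}\mid C;C'\mid C\parallel C'\mid \mathsf{if}\,B\,\mathsf{then}\,C\,\mathsf{else}\,C'\mid \mathsf{while}\,B\,\mathsf{do}\,C\mid \mathsf{resource}\ r\ \mathsf{do}\ C\mid \mathsf{with}\ r\ \mathsf{when}\ B\ \mathsf{do}\ C$ denotes a set of traces $[\![C]\!]$ with a subset $|[\![C]\!]|$ of returning traces, defined by induction: * an instruction $m$ denotes the empty traces (no Code transition) and the traces with the single Code transition $m$, which return when it succeeds; $\mathsf{skip}$ denotes $\mathsf{nop}$; * $[\![C;C']\!]$ consists of the traces of $C$ and of the concatenations of a returning trace of $C$ with a trace of $C'$, which return when the latter does; * $[\![C\parallel C']\!]$ consists of the traces whose Code transitions are a shuffle of those of coinitial and cofinal traces of $C$ and $C'$, and return when both do; * $[\![\mathsf{with}\ r\ \mathsf{when}\ B\ \mathsf{do}\ C]\!]$ consists of the traces of $P(r);C;V(r)$ with $B$ true in $\mathfrak s_2$; * conditionals and loops test $B$ with a $\mathsf{nop}$ step; a loop is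 the union of its finite unfoldings; * in each of the constructs with a test, if $B$ cannot be evaluated in $\mathfrak s_2$, the Code makes one erroneous step (reading an unallocated variable of $B$) and does not return; * $[\![\mathsf{resource}\ r\ \mathsf{do}\ C]\!]$ consists of the traces of $C$ in which $r$ is unlocked at the start and the Environment never locks or releases $r$, after removal of $r$ from all lock states and replacement of $P(r)$, $V(r)$ by $\mathsf{nop}$. The Environment is passive in a trace when all its Environment transitions are identities. **Logic.** Permissions form a partial commutative cancellative semigroup $\mathbf{Perm}$ such that $p\cdot q\neq p$ for all $p,q$ (that is, adjoining a unit gives a cancellative partial monoid), with an element $\top$ such that $\top\cdot p$ is undefined for all $p$. A logical state $\sigma$ is a memory state with a permission attached to each allocated variable and location; $\sigma*\sigma'$ is defined when $\sigma$ and $\sigma'$ agree on the values in their common domain and the products of the permissions there are defined. Formulas are built from $\mathbf{emp}$ (empty heap), $\mathrm{True}$, $\mathrm{False}$, $\vee$, $\wedge$, $\neg$, $\Rightarrow$, $\forall X$, $\exists X$, $*$, $\mathrm{own}_p(x)$, $E\mapsto^pE'$ (the heap is exactly one cell) and $E=E'$, where expressions may also contain logical variables with values in $\mathbf{Val}$,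 and where $E\mapsto^p E'$ and $E=E'$ require that the variables of $E,E'$ are in the stack; $E\mapsto E'$ means $E\mapsto^\top E'$, and $E\mapsto -$ means $\exists X.\,E\mapsto X$. A context $\Gamma$ is a partial function from resources to formulas. $\Gamma\vdash\{P\}C\{Q\}$ is derivable when it has a derivation tree with the axioms $$\begin{gathered}\{\mathrm{own}_\top(x)\wedge X=E\}\;x:=E\;\{\mathrm{own}_\top(x)\wedge x=X\},\qquad \{E\mapsto-\,\wedge E'=E'\}\;[E]:=E'\;\{E\mapsto E'\},\\ \{E\mapsto^pv*\mathrm{own}_\top(x)\}\;x:=[E]\;\{E\mapsto^pv*(\mathrm{own}_\top(x)\wedge x=v)\}\ \ (x\notin\mathrm{fv}(E)),\\ \{\mathrm{own}_\top(x)\wedge X=E\wedge\mathbf{emp}\}\;x:=\mathsf{alloc}(E)\;\{\mathrm{own}_\top(x)\wedge x\mapsto X\},\\ \{E\mapsto-\}\;\mathsf{dispose}(E)\;\{\mathbf{emp}\},\qquad\{P\}\;\mathsf{skip}\;\{P\}\end{gathered}$$ in every context (here $X$ and $v$ contain no program variable, and $E$, $E'$ no logical variable), with the rules for sequential composition, parallel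 composition ($\{P_1\}C_1\{Q_1\}$ and $\{P_2\}C_2\{Q_2\}$ give $\{P_1*P_2\}C_1\parallel C_2\{Q_1*Q_2\}$), conditional and loop (with $P\Rightarrow\mathrm{def}(B)$, i.e. $B$ can be evaluated wherever $P$ holds), frame, consequence, conjunction (only for $\Gamma$ consisting of precise formulas), and with $$\frac{\Gamma,r{:}J\vdash\{P\}C\{Q\}}{\Gamma\vdash\{P*J\}\,\mathsf{resource}\ r\ \mathsf{do}\ C\,\{Q*J\}}\qquad\frac{P\Rightarrow\mathrm{def}(B)\quad\Gamma\vdash\{(P*J)\wedge B\}C\{Q*J\}}{\Gamma,r{:}J\vdash\{P\}\,\mathsf{with}\ r\ \mathsf{when}\ B\ \mathsf{do}\ C\,\{Q\}}\qquad(r\notin\mathrm{dom}\,\Gamma).$$ For a fixed valuation of the logical variables, a machine state $(\mu,L)$ satisfies a formula when some logical state $\sigma$ with underlying memory state $\mu$ satisfies it. **Statement.** Suppose that $\emptyset\vdash\{P\}C\{Q\}$ is derivable, and let $t\in[\![C]\!]$ be a trace $$\mathfrak s_1\xrightarrow{id}\mathfrak s_1\xrightarrow{m_1}\mathfrak s_3\xrightarrow{id}\mathfrak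 s_3\xrightarrow{m_2}\cdots\xrightarrow{m_p}\mathfrak s_{2p+1}\xrightarrow{id}\mathfrak s_{2p+1}$$ in which the Environment is passive, and such that $\mathfrak s_1\vDash P*\mathrm{True}$. Then every Code transition $m_i$ of $t$ is a successful machine step, so that $t$ produces no runtime error. If moreover $t\in|[\![C]\!]|$ returns, then its final state satisfies $Q*\mathrm{True}$ (for the same valuation of the logical variables). -/

import Mathlib

/-! ## Memory states and machine states

Values are integers and locations are natural numbers, seen as integers. -/

namespace CSL

/-- Partial functions with finite domain. -/
@[ext]
structure FinPFun (α β : Type*) where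
  toFun : α → Option β
  finite_dom : {a | toFun a ≠ none}.Finite

namespace FinPFun

variable {α β : Type*}

instance : CoeFun (FinPFun α β) (fun _ => α → Option β) := ⟨FinPFun.toFun⟩

/-- The function `f` with the value at `a` set to `b`; the point `a` is removed from the domain
when `b = none`. -/
def set [DecidableEq α] (f : FinPFun α β) (a : α) (b : Option β) : FinPFun α β where
  toFun := Function.update f.toFun a b
  finite_dom := by
    refine (f.finite_dom.insert a).subset fun c hc => ?_
    by_cases h : c = a
    · exact Or.inl h
    · right
      simpa [Function.update_of_ne h] using hc

/-- Post-composition with a function on values. -/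
def map {γ : Type*} (g : β → γ) (f : FinPFun α β) : FinPFun α γ where
  toFun a := (f a).map g
  finite_dom := f.finite_dom.subset fun a ha => by
    intro h
    apply ha
    simp [h]

end FinPFun

/-- Memory states: a finite stack and a finite heap. -/
@[ext]
structure MemState (Var : Type*) where
  stack : FinPFun Var ℤ
  heap : FinPFun ℕ ℤ

/-- Machine states: a memory state and the set of locked resources. -/
@[ext]
structure MState (Var Lock : Type*) where
  mem : MemState Var
  locks : Set Lock

/-! ## Expressions -/

/-- Arithmetic expressions over a set `V` of variables. -/
inductive Expr (V : Type*) where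
  | const (n : ℤ)
  | var (x : V)
  | add (E E' : Expr V)
  | mul (E E' : Expr V)

/-- Evaluation of an expression; it is undefined when one of its variables is. -/
def Expr.eval {V : Type*} (env : V → Option ℤ) : Expr V → Option ℤ
  | .const n => some n
  | .var x => env x
  | .add E E' => do
      let a ← E.eval env
      let b ← E'.eval env
      return a + b
  | .mul E E' => do
      let a ← E.eval env
      let b ← E'.eval env
      return a * b

/-- Free variables of an expression. -/
def Expr.fv {V : Type*} : Expr V → Set V
  | .const _ => ∅
  | .var x => {x}
  | .add E E' => E.fv ∪ E'.fv
  | .mul E E' => E.fv ∪ E'.fv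

/-- Renaming of variables. -/
def Expr.rename {V W : Type*} (f : V → W) : Expr V → Expr W
  | .const n => .const n
  | .var x => .var (f x)
  | .add E E' => .add (E.rename f) (E'.rename f)
  | .mul E E' => .mul (E.rename f) (E'.rename f)

/-- Boolean expressions. -/
inductive BExpr (V : Type*) where
  | tru
  | fls
  | and (B B' : BExpr V)
  | or (B B' : BExpr V)
  | eq (E E' : Expr V)

/-- Evaluation of a Boolean expression; `none` is the outcome `abort`. -/
def BExpr.eval {V : Type*} (env : V → Option ℤ) : BExpr V → Option Bool
  | .tru => some true
  | .fls => some false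
  | .and B B' => do
      let a ← B.eval env
      let b ← B'.eval env
      return a && b
  | .or B B' => do
      let a ← B.eval env
      let b ← B'.eval env
      return a || b
  | .eq E E' => do
      let a ← E.eval env
      let b ← E'.eval env
      return decide (a = b)

/-- Free variables of a Boolean expression. -/
def BExpr.fv {V : Type*} : BExpr V → Set V
  | .tru => ∅
  | .fls => ∅
  | .and B B' => B.fv ∪ B'.fv
  | .or B B' => B.fv ∪ B'.fv
  | .eq E E' => E.fv ∪ E'.fv

/-! ## Machine instructions and machine steps -/

inductive Instr (Var Lock : Type*) where
  | assign (x : Var) (E : Expr Var)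
  | load (x : Var) (E : Expr Var)
  | store (E E' : Expr Var)
  | nop
  | alloc (x : Var) (E : Expr Var)
  | dispose (E : Expr Var)
  | P (r : Lock)
  | V (r : Lock)

section Machine

variable {Var Lock : Type*} [DecidableEq Var]

/-- `Returns m s s'`: the instruction `m` executes successfully from `s` to `s'`. -/
def Returns : Instr Var Lock → MState Var Lock → MState Var Lock → Prop
  | .assign x E, s, s' =>
      ∃ v : ℤ, E.eval s.mem.stack = some v ∧
        s' = ⟨⟨s.mem.stack.set x (some v), s.mem.heap⟩, s.locks⟩
  | .load x E, s, s' =>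
      ∃ (l : ℕ) (v : ℤ), E.eval s.mem.stack = some (l : ℤ) ∧ s.mem.heap l = some v ∧
        s' = ⟨⟨s.mem.stack.set x (some v), s.mem.heap⟩, s.locks⟩
  | .store E E', s, s' =>
      ∃ (l : ℕ) (v : ℤ), E.eval s.mem.stack = some (l : ℤ) ∧ s.mem.heap l ≠ none ∧
        E'.eval s.mem.stack = some v ∧
        s' = ⟨⟨s.mem.stack, s.mem.heap.set l (some v)⟩, s.locks⟩
  | .nop, s, s' => s' = s
  | .alloc x E, s, s' =>
      ∃ (l : ℕ) (v : ℤ), E.eval s.mem.stack = some v ∧ s.mem.heap l = none ∧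
        s' = ⟨⟨s.mem.stack.set x (some (l : ℤ)), s.mem.heap.set l (some v)⟩, s.locks⟩
  | .dispose E, s, s' =>
      ∃ l : ℕ, E.eval s.mem.stack = some (l : ℤ) ∧ s.mem.heap l ≠ none ∧
        s' = ⟨⟨s.mem.stack, s.mem.heap.set l none⟩, s.locks⟩
  | .P r, s, s' => r ∉ s.locks ∧ s' = ⟨s.mem, insert r s.locks⟩
  | .V r, s, s' => r ∈ s.locks ∧ s' = ⟨s.mem, s.locks \ {r}⟩

/-- `Faults m s s'`: the instruction `m` produces a runtime error in the state `s` (which is left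
unchanged). This happens when `m` cannot execute successfully, except that `P(r)` waits for the
resource `r` instead of failing. -/
def Faults (m : Instr Var Lock) (s s' : MState Var Lock) : Prop :=
  s' = s ∧ (∀ r, m ≠ .P r) ∧ ¬ ∃ s'', Returns m s s''

/-- Machine steps, successful or not. -/
def MachineStep (m : Instr Var Lock) (s s' : MState Var Lock) : Prop :=
  Returns m s s' ∨ Faults m s s'

end Machine

/-! ## Traces -/

/-- A transition played by the Code. -/
structure CodeStep (Var Lock : Type*) where
  src : MState Var Lock
  instr : Instr Var Lock
  tgt : MState Var Lock

/-- A trace `s₁ →env s₂ →m₁ s₃ →env … →env s₂ₚ →mₚ s₂ₚ₊₁ →env s₂ₚ₊₂`, given by its initial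
state, its sequence of Code transitions, and its final state. -/
@[ext]
structure Trace (Var Lock : Type*) [DecidableEq Var] where
  src : MState Var Lock
  steps : List (CodeStep Var Lock)
  tgt : MState Var Lock
  valid : ∀ c ∈ steps, MachineStep c.instr c.src c.tgt

/-- `Shuffle l₁ l₂ l`: the list `l` is a shuffle (an order-preserving interleaving) of `l₁`
and `l₂`. -/
inductive Shuffle {α : Type*} : List α → List α → List α → Prop
  | nil : Shuffle [] [] []
  | left (a : α) {l₁ l₂ l : List α} : Shuffle l₁ l₂ l → Shuffle (a :: l₁) l₂ (a :: l)
  | right (a : α) {l₁ l₂ l : List α} : Shuffle l₁ l₂ l → Shuffle l₁ (a :: l₂) (a :: l)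

/-- Forget that `r` is locked. -/
def MState.hide {Var Lock : Type*} (r : Lock) (s : MState Var Lock) : MState Var Lock :=
  ⟨s.mem, s.locks \ {r}⟩

open Classical in
/-- Replace `P(r)` and `V(r)` by `nop`. -/
noncomputable def Instr.hide {Var Lock : Type*} (r : Lock) (m : Instr Var Lock) :
    Instr Var Lock :=
  if m = .P r ∨ m = .V r then .nop else m

section Hide

variable {Var Lock : Type*} [DecidableEq Var]

theorem Returns.hide {m : Instr Var Lock} {s s' : MState Var Lock} (r : Lock)
    (h : Returns m s s') : Returns (m.hide r) (s.hide r) (s'.hide r) := by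
  cases m with
  | P q =>
    obtain ⟨h1, rfl⟩ := h
    by_cases hq : q = r
    · subst hq
      simp [Instr.hide, Returns, MState.hide]
    · rw [show Instr.hide r (.P q : Instr Var Lock) = .P q by simp [Instr.hide, hq]]
      refine ⟨fun h => h1 h.1, ?_⟩
      simp only [MState.hide, MState.mk.injEq, true_and]
      ext z
      simp only [Set.mem_sdiff, Set.mem_insert_iff, Set.mem_singleton_iff]
      grind
  | V q =>
    obtain ⟨h1, rfl⟩ := h
    by_cases hq : q = r
    · subst hq
      simp [Instr.hide, Returns, MState.hide]
    · rw [show Instr.hide r (.V q : Instr Var Lock) = .V q by simp [Instr.hide, hq]]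
      refine ⟨⟨h1, hq⟩, ?_⟩
      simp only [MState.hide, MState.mk.injEq, true_and]
      ext z
      simp only [Set.mem_sdiff, Set.mem_singleton_iff]
      grind
  | nop => simpa [Instr.hide, Returns] using congrArg (MState.hide r) h
  | assign x E =>
    obtain ⟨v, h1, rfl⟩ := h
    simpa [Instr.hide, Returns, MState.hide] using ⟨v, h1, rfl⟩
  | load x E =>
    obtain ⟨l, v, h1, h2, rfl⟩ := h
    simpa [Instr.hide, Returns, MState.hide] using ⟨l, h1, v, h2, rfl⟩
  | store E E' =>
    obtain ⟨l, v, h1, h2, h3, rfl⟩ := h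
    simpa [Instr.hide, Returns, MState.hide] using ⟨l, h1, h2, v, h3, rfl⟩
  | alloc x E =>
    obtain ⟨l, v, h1, h2, rfl⟩ := h
    simp only [Instr.hide, reduceCtorEq, or_self, if_false]
    exact ⟨l, v, h1, h2, rfl⟩
  | dispose E =>
    obtain ⟨l, h1, h2, rfl⟩ := h
    simp only [Instr.hide, reduceCtorEq, or_self, if_false]
    exact ⟨l, h1, h2, rfl⟩

theorem exists_returns_of_hide {m : Instr Var Lock} {s s' : MState Var Lock} {r : Lock}
    (hP : ∀ q, m ≠ .P q) (hV : m ≠ .V r) (h : Returns m (s.hide r) s') :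
    ∃ s'', Returns m s s'' := by
  cases m with
  | P q => exact absurd rfl (hP q)
  | V q => exact ⟨_, h.1.1, rfl⟩
  | nop => exact ⟨_, rfl⟩
  | assign x E => obtain ⟨v, h1, -⟩ := h; exact ⟨_, v, h1, rfl⟩
  | load x E => obtain ⟨l, v, h1, h2, -⟩ := h; exact ⟨_, l, v, h1, h2, rfl⟩
  | store E E' => obtain ⟨l, v, h1, h2, h3, -⟩ := h; exact ⟨_, l, v, h1, h2, h3, rfl⟩
  | alloc x E => obtain ⟨l, v, h1, h2, -⟩ := h; exact ⟨_, l, v, h1, h2, rfl⟩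
  | dispose E => obtain ⟨l, h1, h2, -⟩ := h; exact ⟨_, l, h1, h2, rfl⟩

theorem MachineStep.hide {m : Instr Var Lock} {s s' : MState Var Lock} (r : Lock)
    (h : MachineStep m s s') : MachineStep (m.hide r) (s.hide r) (s'.hide r) := by
  rcases h with h | ⟨rfl, hP, hn⟩
  · exact Or.inl (h.hide r)
  · by_cases hV : m = .V r
    · left
      simp [Instr.hide, hV, Returns]
    · right
      have e : m.hide r = m := by simp [Instr.hide, hV, hP r]
      rw [e]
      exact ⟨rfl, hP, fun ⟨_, h⟩ => hn (exists_returns_of_hide hP hV h)⟩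

end Hide

namespace Trace

variable {Var Lock : Type*} [DecidableEq Var]

/-- The transitions played by the Environment. -/
def envMoves (t : Trace Var Lock) : List (MState Var Lock × MState Var Lock) :=
  (t.src :: t.steps.map CodeStep.tgt).zip (t.steps.map CodeStep.src ++ [t.tgt])

/-- The Environment is passive: all its transitions are identities. -/
def Passive (t : Trace Var Lock) : Prop :=
  ∀ e ∈ t.envMoves, e.1 = e.2

/-- The state `s₂`, from which the Code plays first (the final state if the trace is empty). -/
def codeSrc (t : Trace Var Lock) : MState Var Lock :=
  (t.steps.map CodeStep.src ++ [t.tgt]).head (by simp)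

/-- Sequential composition `t · t'` (used only when `t.tgt = t'.src`). -/
def comp (t t' : Trace Var Lock) : Trace Var Lock where
  src := t.src
  steps := t.steps ++ t'.steps
  tgt := t'.tgt
  valid c hc := (List.mem_append.1 hc).elim (t.valid c) (t'.valid c)

/-- `t` belongs to the parallel composition of `t₁` and `t₂`: the three traces are coinitial and
cofinal, and the Code transitions of `t` are a shuffle of those of `t₁` and `t₂`. -/
def IsPar (t₁ t₂ t : Trace Var Lock) : Prop :=
  t₁.src = t.src ∧ t₂.src = t.src ∧ t₁.tgt = t.tgt ∧ t₂.tgt = t.tgt ∧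
    Shuffle t₁.steps t₂.steps t.steps

/-- Hiding of the resource `r` in the states and in the instructions of a trace. -/
noncomputable def hide (r : Lock) (t : Trace Var Lock) : Trace Var Lock where
  src := t.src.hide r
  steps := t.steps.map fun c => ⟨c.src.hide r, c.instr.hide r, c.tgt.hide r⟩
  tgt := t.tgt.hide r
  valid c hc := by
    obtain ⟨d, hd, rfl⟩ := List.mem_map.1 hc
    exact (t.valid d hd).hide r

/-- The resource `r` is private to the Code in `t`: it is available at the start, and no
transition of the Environment locks or releases it. -/
def Private (r : Lock) (t : Trace Var Lock) : Prop :=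
  r ∉ t.src.locks ∧ ∀ e ∈ t.envMoves, (r ∈ e.1.locks ↔ r ∈ e.2.locks)

end Trace

/-! ## Transition systems -/

/-- A set of traces, together with the subset of those that return. -/
structure TransSys (Var Lock : Type*) [DecidableEq Var] where
  traces : Set (Trace Var Lock)
  ret : Set (Trace Var Lock)
  ret_subset : ret ⊆ traces

namespace TransSys

variable {Var Lock : Type*} [DecidableEq Var]

/-- The empty transition system. -/
def empty : TransSys Var Lock := ⟨∅, ∅, Set.empty_subset _⟩

/-- Union of two transition systems. -/
def union (T T' : TransSys Var Lock) : TransSys Var Lock :=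
  ⟨T.traces ∪ T'.traces, T.ret ∪ T'.ret, Set.union_subset_union T.ret_subset T'.ret_subset⟩

/-- Union of a family of transition systems. -/
def iUnion {ι : Type*} (T : ι → TransSys Var Lock) : TransSys Var Lock :=
  ⟨⋃ i, (T i).traces, ⋃ i, (T i).ret, Set.iUnion_mono fun i => (T i).ret_subset⟩

/-- Sequential composition. -/
def seq (T T' : TransSys Var Lock) : TransSys Var Lock where
  traces := T.traces ∪
    {u | ∃ t ∈ T.ret, ∃ t' ∈ T'.traces, t.tgt = t'.src ∧ u = t.comp t'}
  ret := {u | ∃ t ∈ T.ret, ∃ t' ∈ T'.ret, t.tgt = t'.src ∧ u = t.comp t'}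
  ret_subset := by
    rintro u ⟨t, ht, t', ht', h, rfl⟩
    exact Or.inr ⟨t, ht, t', T'.ret_subset ht', h, rfl⟩

/-- Parallel composition. -/
def par (T T' : TransSys Var Lock) : TransSys Var Lock where
  traces := {u | ∃ t ∈ T.traces, ∃ t' ∈ T'.traces, Trace.IsPar t t' u}
  ret := {u | ∃ t ∈ T.ret, ∃ t' ∈ T'.ret, Trace.IsPar t t' u}
  ret_subset := by
    rintro u ⟨t, ht, t', ht', h⟩
    exact ⟨t, T.ret_subset ht, t', T'.ret_subset ht', h⟩

/-- Hiding of a resource `r`, which is private to the Code during the hidden execution. -/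
noncomputable def hide (r : Lock) (T : TransSys Var Lock) : TransSys Var Lock where
  traces := {u | ∃ t ∈ T.traces, t.Private r ∧ u = t.hide r}
  ret := {u | ∃ t ∈ T.ret, t.Private r ∧ u = t.hide r}
  ret_subset := by
    rintro u ⟨t, ht, h⟩
    exact ⟨t, T.ret_subset ht, h⟩

/-- The transition system of an instruction: the execution of `m` has not begun yet, or it is
done; it returns when it is done and has succeeded. -/
def ofInstr (m : Instr Var Lock) : TransSys Var Lock where
  traces := {t | t.steps = [] ∨ ∃ s s', t.steps = [⟨s, m, s'⟩]}
  ret := {t | ∃ s s', t.steps = [⟨s, m, s'⟩] ∧ Returns m s s'}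
  ret_subset := by
    rintro t ⟨s, s', h, -⟩
    exact Or.inr ⟨s, s', h⟩

/-- Execution inside a critical section. -/
def inside (r : Lock) (T : TransSys Var Lock) : TransSys Var Lock :=
  ((ofInstr (.P r)).seq T).seq (ofInstr (.V r))

/-- The traces in which `B` evaluates to `b` in the first state from which the Code plays. -/
def whenB (B : BExpr Var) (b : Bool) (T : TransSys Var Lock) : TransSys Var Lock where
  traces := {t ∈ T.traces | B.eval t.codeSrc.mem.stack = some b}
  ret := {t ∈ T.ret | B.eval t.codeSrc.mem.stack = some b}
  ret_subset := fun _ ht => ⟨T.ret_subset ht.1, ht.2⟩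

/-- The evaluation of `B` aborts: the Code fails (and does not return) by reading a variable `x`
of `B` which is not allocated. The read is the erroneous machine step `x := x`. -/
def whenAbort (B : BExpr Var) : TransSys Var Lock where
  traces := {t | B.eval t.codeSrc.mem.stack = none ∧
    (t.steps = [] ∨ ∃ s s', ∃ x ∈ B.fv, s.mem.stack x = none ∧
      t.steps = [⟨s, .assign x (.var x), s'⟩])}
  ret := ∅
  ret_subset := Set.empty_subset _

end TransSys

/-! ## The concurrent language and its trace semantics -/

inductive Cmd (Var Lock : Type*) where
  | assign (x : Var) (E : Expr Var)
  | load (x : Var) (E : Expr Var)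
  | store (E E' : Expr Var)
  | seq (C C' : Cmd Var Lock)
  | par (C C' : Cmd Var Lock)
  | skip
  | while (B : BExpr Var) (C : Cmd Var Lock)
  | resource (r : Lock) (C : Cmd Var Lock)
  | withWhen (r : Lock) (B : BExpr Var) (C : Cmd Var Lock)
  | ite (B : BExpr Var) (C C' : Cmd Var Lock)
  | alloc (x : Var) (E : Expr Var)
  | dispose (E : Expr Var)

open TransSys in
/-- The transition system of a command. -/
noncomputable def Cmd.sem {Var Lock : Type*} [DecidableEq Var] :
    Cmd Var Lock → TransSys Var Lock
  | .assign x E => ofInstr (.assign x E)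
  | .load x E => ofInstr (.load x E)
  | .store E E' => ofInstr (.store E E')
  | .skip => ofInstr .nop
  | .alloc x E => ofInstr (.alloc x E)
  | .dispose E => ofInstr (.dispose E)
  | .seq C C' => C.sem.seq C'.sem
  | .par C C' => C.sem.par C'.sem
  | .resource r C => C.sem.hide r
  | .withWhen r B C => (whenB B true (inside r C.sem)).union (whenAbort B)
  | .ite B C C' =>
      (((whenB B true (ofInstr .nop)).seq C.sem).union
        ((whenB B false (ofInstr .nop)).seq C'.sem)).union (whenAbort B)
  | .while B C =>
      TransSys.iUnion fun n : ℕ =>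
        (fun T => ((((whenB B true (ofInstr .nop)).seq C.sem).seq T).union
          (whenB B false (ofInstr .nop))).union (whenAbort B))^[n] TransSys.empty

/-! ## Permissions and logical states -/

/-- The permission monoid: a partial commutative cancellative multiplication with an element `⊤`
which has no multiple. Since `⊤ · x` is never defined, the neutral element of the monoid is not a
permission: cancellativity (`p · q = p · q'` implies `q = q'`) is stated for permissions, and also
in the case where `q'` is the neutral element. -/
class PermMonoid (Perm : Type*) where
  op : Perm → Perm → Option Perm
  op_comm : ∀ p q, op p q = op q p
  op_assoc : ∀ p q r, (op p q).bind (fun a => op a r) = (op q r).bind (fun a => op p a)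
  op_cancel : ∀ p q q' r, op p q = some r → op p q' = some r → q = q'
  op_ne_self : ∀ p q, op p q ≠ some p
  top : Perm
  top_op : ∀ p, op top p = none

/-- Logical states: memory states with permissions. -/
@[ext]
structure LState (Var Perm : Type*) where
  stack : FinPFun Var (ℤ × Perm)
  heap : FinPFun ℕ (ℤ × Perm)

section Logic

variable {Var Lock Perm : Type*}

/-- The memory state underlying a logical state. -/
def LState.forget (σ : LState Var Perm) : MemState Var :=
  ⟨σ.stack.map Prod.fst, σ.heap.map Prod.fst⟩

/-- `CellJoin a b c`: at one variable or location, `c` is the product of `a` and `b`. -/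
inductive CellJoin [PermMonoid Perm] :
    Option (ℤ × Perm) → Option (ℤ × Perm) → Option (ℤ × Perm) → Prop
  | left (a : Option (ℤ × Perm)) : CellJoin a none a
  | right (b : Option (ℤ × Perm)) : CellJoin none b b
  | both (v : ℤ) (p q r : Perm) (h : PermMonoid.op p q = some r) :
      CellJoin (some (v, p)) (some (v, q)) (some (v, r))

/-- `IsSep σ₁ σ₂ σ`: the separation product `σ₁ * σ₂` is defined and equal to `σ`. -/
def IsSep [PermMonoid Perm] (σ₁ σ₂ σ : LState Var Perm) : Prop :=
  (∀ x, CellJoin (σ₁.stack x) (σ₂.stack x) (σ.stack x)) ∧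
    ∀ l, CellJoin (σ₁.heap l) (σ₂.heap l) (σ.heap l)

/-! ## Formulas -/

/-- Logical variables. -/
abbrev LVar := ℕ

/-- Expressions of the logic contain program variables and logical variables. -/
abbrev LExpr (Var : Type*) := Expr (Var ⊕ LVar)

/-- A program expression, as an expression of the logic. -/
def Expr.prog (E : Expr Var) : LExpr Var := E.rename Sum.inl

/-- An expression with logical variables only, as an expression of the logic. -/
def Expr.logical (E : Expr LVar) : LExpr Var := E.rename Sum.inr

inductive Formula (Var Perm : Type*) where
  | emp
  | tru
  | fls
  | or (P Q : Formula Var Perm)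
  | and (P Q : Formula Var Perm)
  | not (P : Formula Var Perm)
  | imp (P Q : Formula Var Perm)
  | all (X : LVar) (P : Formula Var Perm)
  | ex (X : LVar) (P : Formula Var Perm)
  | star (P Q : Formula Var Perm)
  | own (p : Perm) (x : Var)
  | pointsTo (E : LExpr Var) (p : Perm) (E' : LExpr Var)
  | eq (E E' : LExpr Var)

/-- The values of the program variables in the logical state `σ`, and of the logical variables
in the valuation `ρ`. -/
def LState.env (ρ : LVar → ℤ) (σ : LState Var Perm) : Var ⊕ LVar → Option ℤ :=
  Sum.elim (σ.stack.map Prod.fst) (fun X => some (ρ X))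

/-- Satisfaction of a formula by a logical state, for a valuation of the logical variables. An
equation between expressions can hold only if their variables belong to the stack; `emp` and
`E ↦ᵖ E'` specify the heap exactly. -/
def Sat [PermMonoid Perm] (ρ : LVar → ℤ) (σ : LState Var Perm) : Formula Var Perm → Prop
  | .emp => ∀ l, σ.heap l = none
  | .tru => True
  | .fls => False
  | .or P Q => Sat ρ σ P ∨ Sat ρ σ Q
  | .and P Q => Sat ρ σ P ∧ Sat ρ σ Q
  | .not P => ¬ Sat ρ σ P
  | .imp P Q => Sat ρ σ P → Sat ρ σ Q
  | .all X P => ∀ v : ℤ, Sat (Function.update ρ X v) σ P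
  | .ex X P => ∃ v : ℤ, Sat (Function.update ρ X v) σ P
  | .star P Q => ∃ σ₁ σ₂, IsSep σ₁ σ₂ σ ∧ Sat ρ σ₁ P ∧ Sat ρ σ₂ Q
  | .own p x => ∃ v, σ.stack x = some (v, p)
  | .pointsTo E p E' =>
      ∃ (l : ℕ) (v : ℤ), E.eval (σ.env ρ) = some (l : ℤ) ∧ E'.eval (σ.env ρ) = some v ∧
        σ.heap l = some (v, p) ∧ ∀ l', l' ≠ l → σ.heap l' = none
  | .eq E E' => ∃ v : ℤ, E.eval (σ.env ρ) = some v ∧ E'.eval (σ.env ρ) = some v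

/-- A machine state satisfies a formula when its memory state underlies a logical state that
does. -/
def MState.Satisfies [PermMonoid Perm] (ρ : LVar → ℤ) (s : MState Var Lock)
    (P : Formula Var Perm) : Prop :=
  ∃ σ : LState Var Perm, σ.forget = s.mem ∧ Sat ρ σ P

/-- Entailment `P ⇒ Q`. -/
def Entails [PermMonoid Perm] (P Q : Formula Var Perm) : Prop :=
  ∀ ρ σ, Sat ρ σ P → Sat ρ σ Q

/-- `P ⇒ def(B)`: the evaluation of `B` succeeds in every state which satisfies `P`. -/
def EntailsDef [PermMonoid Perm] (P : Formula Var Perm) (B : BExpr Var) : Prop :=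
  ∀ ρ (σ : LState Var Perm), Sat ρ σ P → B.eval (σ.stack.map Prod.fst) ≠ none

/-- Precise formulas. -/
def Precise [PermMonoid Perm] (P : Formula Var Perm) : Prop :=
  ∀ (ρ : LVar → ℤ) (σ σ₁ σ₂ : LState Var Perm),
    (∃ σ', IsSep σ₁ σ' σ) → Sat ρ σ₁ P → (∃ σ', IsSep σ₂ σ' σ) → Sat ρ σ₂ P → σ₁ = σ₂

/-- A Boolean expression, as a formula. -/
def BExpr.formula : BExpr Var → Formula Var Perm
  | .tru => .tru
  | .fls => .fls
  | .and B B' => .and B.formula B'.formula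
  | .or B B' => .or B.formula B'.formula
  | .eq E E' => .eq E.prog E'.prog

/-- The formula `E ↦ -`, with full permission. -/
def Formula.pointsToAny [PermMonoid Perm] (E : Expr Var) : Formula Var Perm :=
  .ex 0 (.pointsTo E.prog PermMonoid.top (.var (.inr 0)))

/-! ## Derivable triples -/

/-- Contexts: partial functions from resources to formulas. (The contexts which occur in a
derivation of a triple in the empty context are finite.) -/
abbrev Ctx (Var Lock Perm : Type*) := Lock → Option (Formula Var Perm)

/-- The empty context. -/
def Ctx.empty : Ctx Var Lock Perm := fun _ => none

/-- The triples `Γ ⊢ {P} C {Q}` of concurrent separation logic which have a derivation tree. -/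
inductive Derivable [PermMonoid Perm] [DecidableEq Lock] :
    Ctx Var Lock Perm → Formula Var Perm → Cmd Var Lock → Formula Var Perm → Prop
  | aff (Γ) (x : Var) (E : Expr Var) (X : Expr LVar) :
      Derivable Γ
        (.and (.own PermMonoid.top x) (.eq X.logical E.prog))
        (.assign x E)
        (.and (.own PermMonoid.top x) (.eq (.var (.inl x)) X.logical))
  | store (Γ) (E E' : Expr Var) :
      Derivable Γ
        (.and (.pointsToAny E) (.eq E'.prog E'.prog))
        (.store E E')
        (.pointsTo E.prog PermMonoid.top E'.prog)
  | load (Γ) (x : Var) (E : Expr Var) (p : Perm) (v : Expr LVar) (hx : x ∉ E.fv) :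
      Derivable Γ
        (.star (.pointsTo E.prog p v.logical) (.own PermMonoid.top x))
        (.load x E)
        (.star (.pointsTo E.prog p v.logical)
          (.and (.own PermMonoid.top x) (.eq (.var (.inl x)) v.logical)))
  | alloc (Γ) (x : Var) (E : Expr Var) (X : Expr LVar) :
      Derivable Γ
        (.and (.own PermMonoid.top x) (.and (.eq X.logical E.prog) .emp))
        (.alloc x E)
        (.and (.own PermMonoid.top x) (.pointsTo (.var (.inl x)) PermMonoid.top X.logical))
  | dispose (Γ) (E : Expr Var) :
      Derivable Γ (.pointsToAny E) (.dispose E) .emp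
  | skip (Γ) (P) : Derivable Γ P .skip P
  | seq {Γ P Q R C C'} :
      Derivable Γ P C Q → Derivable Γ Q C' R → Derivable Γ P (.seq C C') R
  | ite {Γ P Q C C'} {B : BExpr Var} :
      EntailsDef P B → Derivable Γ (.and P B.formula) C Q →
      Derivable Γ (.and P (.not B.formula)) C' Q → Derivable Γ P (.ite B C C') Q
  | while {Γ P C} {B : BExpr Var} :
      EntailsDef P B → Derivable Γ (.and P B.formula) C P →
      Derivable Γ P (.while B C) (.and P (.not B.formula))
  | conj {Γ P₁ P₂ Q₁ Q₂ C} :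
      (∀ r J, Γ r = some J → Precise J) →
      Derivable Γ P₁ C Q₁ → Derivable Γ P₂ C Q₂ →
      Derivable Γ (.and P₁ P₂) C (.and Q₁ Q₂)
  | res {Γ P Q J C} {r : Lock} :
      Γ r = none → Derivable (Function.update Γ r (some J)) P C Q →
      Derivable Γ (.star P J) (.resource r C) (.star Q J)
  | withWhen {Γ P Q J C} {B : BExpr Var} {r : Lock} :
      Γ r = none → EntailsDef P B →
      Derivable Γ (.and (.star P J) B.formula) C (.star Q J) →
      Derivable (Function.update Γ r (some J)) P (.withWhen r B C) Q
  | par {Γ P₁ P₂ Q₁ Q₂ C₁ C₂} :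
      Derivable Γ P₁ C₁ Q₁ → Derivable Γ P₂ C₂ Q₂ →
      Derivable Γ (.star P₁ P₂) (.par C₁ C₂) (.star Q₁ Q₂)
  | frame {Γ P Q C} (R) :
      Derivable Γ P C Q → Derivable Γ (.star P R) C (.star Q R)
  | conseq {Γ P P' Q Q' C} :
      Entails P P' → Derivable Γ P' C Q' → Entails Q' Q → Derivable Γ P C Q

end Logic

end CSL

/-!
Soundness is proved on traces, by giving the Code a *ghost* resource `a`, the part of the memory
that it owns. Logical states embed in the commutative monoid `Resource`, a product of cells in
which undefined products are made total with an absorbing element `bad` (`isSep_iff`). At any time,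
the logical state of the whole system is a product `a * i * f` of what the Code owns, of the
invariants `i` of the unlocked resources (`Inv`), and of a frame `f` which belongs to the rest of
the world.

`Safe` follows the Code transitions of a trace. The Environment may replace `i` and `f` by anything
between two of them; each transition of the Code must succeed from every such product, and must turn
`a * i * f` into some `a' * i' * f`, with the same frame. A triple is `Valid` when the Code is safe
from every `a` which satisfies the precondition, and owns a part satisfying the postcondition at the
end of the traces which return. Each rule preserves validity:

* the frame rule and parallel composition hold because what a command does not own is part of its
  frame (`SafeStep.frame`, `Safe.par`);
* a critical section takes the invariant of `r` out of `i` and puts it back (`safeStep_acquire`,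
  `safeStep_release`), and in between the context with `r` and the context without `r` give the
  same `i` (`Safe.critical`);
* hiding `r` gives its invariant to the Code whenever the Code does not hold `r` (`Safe.hide`);
  this needs the Environment not to touch `r`, and the locks held by the Code to be recorded, as
  they are also for the releases `V(r)` to succeed;
* for the conjunction rule (`Safe.and`), the two premises must produce the same `a'`. The logical
  state after a step is a function of the one before and of the new memory (`LState.lift`), precise
  invariants determine `i'`, and then cancellativity determines `a'`.

When the Environment is passive and the context is empty, nothing but the frame stands beside `a`
(`Safe.run`), and the frame is the part which satisfies `True`.
-/

namespace CSL

/-! ### The resource monoid -/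

/-- The contents of one variable or location, with an extra absorbing element `bad` which is the
result of every undefined product. This makes the separation product total. -/
inductive Cell (Perm : Type*) where
  | bad
  | empty
  | full (v : ℤ) (p : Perm)

namespace Cell

variable {Perm : Type*}

/-- The cell with the given contents. -/
def ofOption : Option (ℤ × Perm) → Cell Perm
  | none => .empty
  | some (v, p) => .full v p

/-- The contents of a cell; `none` is a junk value at `bad`. -/
def toOption : Cell Perm → Option (ℤ × Perm)
  | .full v p => some (v, p)
  | _ => none

@[simp] theorem ofOption_none : ofOption (none : Option (ℤ × Perm)) = .empty := rfl

@[simp] theorem ofOption_some (c : ℤ × Perm) : ofOption (some c) = .full c.1 c.2 := rfl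

theorem ofOption_injective : Function.Injective (ofOption : Option (ℤ × Perm) → Cell Perm) := by
  rintro (_ | ⟨v, p⟩) (_ | ⟨w, q⟩) h <;> simp_all

theorem ofOption_ne_bad (o : Option (ℤ × Perm)) : ofOption o ≠ .bad := by
  rcases o with _ | ⟨v, p⟩ <;> simp

theorem ofOption_toOption {c : Cell Perm} (h : c ≠ .bad) : ofOption c.toOption = c := by
  cases c <;> simp_all [toOption]

instance : One (Cell Perm) := ⟨.empty⟩

theorem one_def : (1 : Cell Perm) = .empty := rfl

variable [PermMonoid Perm]

/-- The separation product: two full cells are compatible when they hold the same value and their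
permissions have a product. -/
def mul : Cell Perm → Cell Perm → Cell Perm
  | .bad, _ => .bad
  | _, .bad => .bad
  | .empty, c => c
  | c, .empty => c
  | .full v p, .full w q =>
      if v = w then (PermMonoid.op p q).elim .bad (.full v) else .bad

instance : Mul (Cell Perm) := ⟨mul⟩

@[simp] theorem bad_mul (c : Cell Perm) : .bad * c = .bad := by cases c <;> rfl

@[simp] theorem mul_bad (c : Cell Perm) : c * .bad = .bad := by cases c <;> rfl

@[simp] theorem empty_mul (c : Cell Perm) : .empty * c = c := by cases c <;> rfl

@[simp] theorem mul_empty (c : Cell Perm) : c * .empty = c := by cases c <;> rfl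

theorem full_mul_full (v w : ℤ) (p q : Perm) :
    (.full v p * .full w q : Cell Perm) =
      if v = w then (PermMonoid.op p q).elim .bad (.full v) else .bad := rfl

theorem full_mul_full_assoc (u v w : ℤ) (p q r : Perm) :
    (.full u p * .full v q * .full w r : Cell Perm) = .full u p * (.full v q * .full w r) := by
  have h := PermMonoid.op_assoc p q r
  by_cases huv : u = v
  · subst huv
    by_cases huw : u = w
    · subst huw
      simp only [full_mul_full, if_true]
      cases h1 : PermMonoid.op p q <;> cases h2 : PermMonoid.op q r <;>
        simp only [h1, h2, Option.bind_some, Option.bind_none] at h <;>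
        simp [full_mul_full, h]
      simp [← h]
    · simp only [full_mul_full, if_true, if_neg huw, mul_bad]
      cases h1 : PermMonoid.op p q <;> simp [full_mul_full, huw]
  · simp only [full_mul_full, if_neg huv, bad_mul]
    by_cases hvw : v = w
    · simp only [if_pos hvw]
      cases h1 : PermMonoid.op q r <;> simp [full_mul_full, huv]
    · rw [if_neg hvw, mul_bad]

instance : CommMonoid (Cell Perm) where
  one_mul := empty_mul
  mul_one := mul_empty
  mul_comm a b := by
    cases a <;> cases b <;> try simp only [bad_mul, mul_bad, empty_mul, mul_empty]
    rename_i v p w q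
    simp only [full_mul_full, PermMonoid.op_comm p q, eq_comm (a := v)]
    split_ifs with h
    · rw [h]
    · rfl
  mul_assoc a b c := by
    cases a <;> cases b <;> cases c <;>
      simp only [bad_mul, mul_bad, empty_mul, mul_empty, full_mul_full_assoc]

theorem cellJoin_iff (a b c : Option (ℤ × Perm)) :
    CellJoin a b c ↔ ofOption c = ofOption a * ofOption b := by
  constructor
  · rintro (_ | _ | ⟨v, p, q, r, h⟩) <;> simp [full_mul_full, *]
  · rcases a with _ | ⟨v, p⟩
    · intro h
      obtain rfl := ofOption_injective (h.trans (empty_mul _))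
      exact .right _
    rcases b with _ | ⟨w, q⟩
    · intro h
      obtain rfl := ofOption_injective (h.trans (mul_empty _))
      exact .left _
    intro h
    simp only [ofOption_some, full_mul_full] at h
    split_ifs at h with hv
    · subst hv
      cases ho : PermMonoid.op p q with
      | none => exact absurd (by simpa [ho] using h) (ofOption_ne_bad c)
      | some r =>
        obtain rfl : c = some (v, r) := ofOption_injective (by simpa [ho] using h)
        exact .both _ _ _ _ ho
    · exact absurd h (ofOption_ne_bad c)

theorem left_ne_bad {a b : Cell Perm} (h : a * b ≠ .bad) : a ≠ .bad := by
  rintro rfl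
  simp at h

/-- A product of cells is empty only if both factors are: the unit is not a permission. -/
theorem left_eq_one {a b : Cell Perm} (h : a * b = 1) : a = 1 := by
  cases a <;> cases b <;> simp_all [one_def, full_mul_full]
  split_ifs at h
  rename_i v p w q _
  cases h' : PermMonoid.op p q <;> simp [h'] at h

/-- Defined products are cancellative. When one of the factors is empty, this is the fact that a
permission is never absorbed. -/
theorem mul_right_cancel {a b c : Cell Perm} (h : a * c = b * c) (hb : a * c ≠ .bad) : a = b := by
  have key : ∀ (v w : ℤ) (p q : Perm),
      (.full v p * .full w q : Cell Perm) ≠ .full w q := by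
    intro v w p q h
    rw [full_mul_full] at h
    split_ifs at h
    cases h' : PermMonoid.op p q with
    | none => simp [h'] at h
    | some r =>
      simp only [h', Option.elim_some, full.injEq] at h
      rw [PermMonoid.op_comm] at h'
      exact PermMonoid.op_ne_self _ _ (h'.trans (by rw [h.2]))
  cases c with
  | bad => simp at hb
  | empty => simpa using h
  | full w r =>
    cases a with
    | bad => simp at hb
    | empty =>
      cases b with
      | bad => simp at h
      | empty => rfl
      | full v q => exact absurd (h.symm.trans (empty_mul _)) (key _ _ _ _)
    | full v p =>
      cases b with
      | bad => exact absurd (h.trans (bad_mul _)) hb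
      | empty => exact absurd (h.trans (empty_mul _)) (key _ _ _ _)
      | full u q =>
        have hu : u = w := by
          by_contra hu
          rw [h, full_mul_full, if_neg hu] at hb
          exact hb rfl
        have hv : v = w := by
          by_contra hv
          rw [full_mul_full, if_neg hv] at hb
          exact hb rfl
        rw [hu, hv] at h ⊢
        rw [hv] at hb
        simp only [full_mul_full, if_true] at h hb
        cases hp : PermMonoid.op p r with
        | none => simp [hp] at hb
        | some a =>
          cases hq : PermMonoid.op q r with
          | none => simp [hp, hq] at h
          | some b =>
            simp only [hp, hq, Option.elim_some, full.injEq, true_and] at h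
            rw [PermMonoid.op_comm] at hp hq
            rw [PermMonoid.op_cancel _ _ _ _ hp (hq.trans (by rw [h]))]

/-- A cell which contains a full cell as a factor has the same value. -/
theorem exists_of_full_mul {v : ℤ} {p : Perm} {c : Cell Perm} {o : Option (ℤ × Perm)}
    (h : ofOption o = .full v p * c) : ∃ q, o = some (v, q) := by
  have h' := (cellJoin_iff (some (v, p)) c.toOption o).2 (by
    rw [ofOption_toOption]
    · exact h
    · rintro rfl
      exact ofOption_ne_bad o (h.trans (mul_bad _)))
  generalize c.toOption = d at h'
  cases h' with
  | left => exact ⟨p, rfl⟩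
  | both v p q r h => exact ⟨r, rfl⟩

/-- Full permission on a cell excludes any other owner. -/
theorem eq_one_of_top_mul {v : ℤ} {c : Cell Perm} {o : Option (ℤ × Perm)}
    (h : ofOption o = .full v PermMonoid.top * c) : c = 1 := by
  cases c with
  | bad => exact absurd (h.trans (mul_bad _)) (ofOption_ne_bad o)
  | empty => rfl
  | full w q =>
    rw [full_mul_full, PermMonoid.top_op] at h
    exact absurd (h.trans (by simp)) (ofOption_ne_bad o)

end Cell

/-- Total separation resources: a cell for each variable and for each location. They form a
commutative monoid for the pointwise product. -/
abbrev Resource (Var Perm : Type*) := Var ⊕ ℕ → Cell Perm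

section LState

variable {Var Perm : Type*}

/-- The resource given by a logical state. -/
def LState.cells (σ : LState Var Perm) : Resource Var Perm :=
  Sum.elim (fun x => .ofOption (σ.stack x)) (fun l => .ofOption (σ.heap l))

@[simp] theorem LState.cells_inl (σ : LState Var Perm) (x : Var) :
    σ.cells (.inl x) = .ofOption (σ.stack x) := rfl

@[simp] theorem LState.cells_inr (σ : LState Var Perm) (l : ℕ) :
    σ.cells (.inr l) = .ofOption (σ.heap l) := rfl

theorem LState.cells_ne_bad (σ : LState Var Perm) (k : Var ⊕ ℕ) : σ.cells k ≠ .bad := by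
  cases k <;> exact Cell.ofOption_ne_bad _

theorem LState.cells_injective : Function.Injective (LState.cells (Var := Var) (Perm := Perm)) := by
  intro σ τ h
  ext1
  · ext1
    funext x
    exact Cell.ofOption_injective (congrFun h (.inl x))
  · ext1
    funext l
    exact Cell.ofOption_injective (congrFun h (.inr l))

@[simp] theorem LState.forget_stack (σ : LState Var Perm) (x : Var) :
    σ.forget.stack x = (σ.stack x).map Prod.fst := rfl

@[simp] theorem LState.forget_heap (σ : LState Var Perm) (l : ℕ) :
    σ.forget.heap l = (σ.heap l).map Prod.fst := rfl

variable [PermMonoid Perm]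

theorem isSep_iff (σ₁ σ₂ σ : LState Var Perm) :
    IsSep σ₁ σ₂ σ ↔ σ.cells = σ₁.cells * σ₂.cells := by
  simp only [IsSep, Cell.cellJoin_iff, funext_iff, Sum.forall]
  rfl

/-- A factor of a logical state is a logical state. -/
theorem exists_cells_eq {a b : Resource Var Perm} {σ : LState Var Perm} (h : σ.cells = a * b) :
    ∃ τ : LState Var Perm, τ.cells = a := by
  have hb : ∀ k, a k ≠ .bad := fun k =>
    Cell.left_ne_bad (b := b k) (by rw [← Pi.mul_apply, ← h]; exact σ.cells_ne_bad k)
  have hn : ∀ k, σ.cells k = .empty → (a k).toOption = none := fun k hk => by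
    rw [Cell.left_eq_one (a := a k) (b := b k) (by rw [← Pi.mul_apply, ← h, hk]; rfl)]
    rfl
  refine ⟨⟨⟨fun x => (a (.inl x)).toOption, σ.stack.finite_dom.subset fun x hx h0 => hx ?_⟩,
    ⟨fun l => (a (.inr l)).toOption, σ.heap.finite_dom.subset fun l hl h0 => hl ?_⟩⟩, ?_⟩
  · exact hn _ (by simp [h0])
  · exact hn _ (by simp [h0])
  · funext k
    cases k <;> exact Cell.ofOption_toOption (hb _)

theorem cells_mul_right_cancel {a b c : Resource Var Perm} {σ : LState Var Perm}
    (ha : σ.cells = a * c) (hb : σ.cells = b * c) : a = b := by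
  funext k
  exact Cell.mul_right_cancel (congrFun (ha.symm.trans hb) k)
    (by simpa [ha] using σ.cells_ne_bad k)

/-- The logical state over the memory `μ` which keeps the permissions of `σ`, and gives full
permission on what is not allocated in `σ`. When the Code takes a step to `μ`, the logical state
of the whole system becomes `σ.lift μ`. -/
def LState.lift (σ : LState Var Perm) (μ : MemState Var) : LState Var Perm where
  stack := ⟨fun x => (μ.stack x).map fun v => (v, ((σ.stack x).map Prod.snd).getD PermMonoid.top),
    μ.stack.finite_dom.subset fun x hx h => hx (by simp [h])⟩
  heap := ⟨fun l => (μ.heap l).map fun v => (v, ((σ.heap l).map Prod.snd).getD PermMonoid.top),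
    μ.heap.finite_dom.subset fun x hx h => hx (by simp [h])⟩

@[simp] theorem LState.lift_stack (σ : LState Var Perm) (μ : MemState Var) (x : Var) :
    (σ.lift μ).stack x =
      (μ.stack x).map fun v => (v, ((σ.stack x).map Prod.snd).getD PermMonoid.top) := rfl

@[simp] theorem LState.lift_heap (σ : LState Var Perm) (μ : MemState Var) (l : ℕ) :
    (σ.lift μ).heap l =
      (μ.heap l).map fun v => (v, ((σ.heap l).map Prod.snd).getD PermMonoid.top) := rfl

theorem LState.forget_lift (σ : LState Var Perm) (μ : MemState Var) :
    (σ.lift μ).forget = μ := by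
  ext1 <;> ext1 <;> funext x <;> simp [LState.forget, FinPFun.map, Function.comp_def]

theorem LState.lift_forget (σ : LState Var Perm) : σ.lift σ.forget = σ := by
  ext1 <;> ext1 <;> funext x
  · simp only [LState.lift_stack, LState.forget_stack]
    rcases σ.stack x with _ | ⟨v, p⟩ <;> rfl
  · simp only [LState.lift_heap, LState.forget_heap]
    rcases σ.heap x with _ | ⟨v, p⟩ <;> rfl

theorem LState.lift_stack_of_eq {σ : LState Var Perm} {μ : MemState Var} {x : Var}
    (h : μ.stack x = σ.forget.stack x) : (σ.lift μ).stack x = σ.stack x := by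
  rw [LState.lift_stack, h, LState.forget_stack]
  rcases σ.stack x with _ | ⟨v, p⟩ <;> rfl

theorem LState.lift_heap_of_eq {σ : LState Var Perm} {μ : MemState Var} {l : ℕ}
    (h : μ.heap l = σ.forget.heap l) : (σ.lift μ).heap l = σ.heap l := by
  rw [LState.lift_heap, h, LState.forget_heap]
  rcases σ.heap l with _ | ⟨v, p⟩ <;> rfl

/-- An update of `a` to `a'` leaves the frame `g` alone when it concerns only cells of which `g`
has no part. -/
theorem cells_eq_mul_of_local {σ σ' : LState Var Perm} {a a' g : Resource Var Perm}
    (h : σ.cells = a * g)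
    (hk : ∀ k, (σ'.cells k = σ.cells k ∧ a' k = a k) ∨ (g k = 1 ∧ σ'.cells k = a' k)) :
    σ'.cells = a' * g := by
  funext k
  rcases hk k with ⟨h1, h2⟩ | ⟨h1, h2⟩
  · rw [h1, h, Pi.mul_apply, Pi.mul_apply, h2]
  · rw [h2, Pi.mul_apply, h1, mul_one]

section Frame

variable {σ τ : LState Var Perm} {g : Resource Var Perm}

theorem stack_of_cells_eq_mul (h : σ.cells = τ.cells * g) {x : Var} {v : ℤ} {p : Perm}
    (hx : τ.stack x = some (v, p)) : ∃ q, σ.stack x = some (v, q) :=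
  Cell.exists_of_full_mul (c := g (.inl x)) (by simpa [hx] using congrFun h (.inl x))

theorem heap_of_cells_eq_mul (h : σ.cells = τ.cells * g) {l : ℕ} {v : ℤ} {p : Perm}
    (hl : τ.heap l = some (v, p)) : ∃ q, σ.heap l = some (v, q) :=
  Cell.exists_of_full_mul (c := g (.inr l)) (by simpa [hl] using congrFun h (.inr l))

theorem frame_stack_eq_one (h : σ.cells = τ.cells * g) {x : Var} {v : ℤ}
    (hx : τ.stack x = some (v, PermMonoid.top)) : g (.inl x) = 1 :=
  Cell.eq_one_of_top_mul (o := σ.stack x) (by simpa [hx] using congrFun h (.inl x))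

theorem frame_heap_eq_one (h : σ.cells = τ.cells * g) {l : ℕ} {v : ℤ}
    (hl : τ.heap l = some (v, PermMonoid.top)) : g (.inr l) = 1 :=
  Cell.eq_one_of_top_mul (o := σ.heap l) (by simpa [hl] using congrFun h (.inr l))

theorem stack_eq_of_top (h : σ.cells = τ.cells * g) {x : Var} {v : ℤ}
    (hx : τ.stack x = some (v, PermMonoid.top)) : σ.stack x = some (v, PermMonoid.top) := by
  have h1 := congrFun h (.inl x)
  rw [Pi.mul_apply, frame_stack_eq_one h hx, mul_one] at h1
  exact (Cell.ofOption_injective h1).trans hx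

theorem heap_eq_of_top (h : σ.cells = τ.cells * g) {l : ℕ} {v : ℤ}
    (hl : τ.heap l = some (v, PermMonoid.top)) : σ.heap l = some (v, PermMonoid.top) := by
  have h1 := congrFun h (.inr l)
  rw [Pi.mul_apply, frame_heap_eq_one h hl, mul_one] at h1
  exact (Cell.ofOption_injective h1).trans hl

theorem frame_heap_eq_one_of_none (h : σ.cells = τ.cells * g) {l : ℕ} (hl : σ.heap l = none) :
    g (.inr l) = 1 := by
  refine Cell.left_eq_one (b := τ.cells (.inr l)) ?_
  rw [mul_comm]
  simpa [hl, Cell.one_def] using (congrFun h (.inr l)).symm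

end Frame

end LState

/-! ### Expressions in larger states -/

section Eval

variable {V W : Type*} {env env' : V → Option ℤ}

theorem Expr.eval_mono (h : ∀ x v, env x = some v → env' x = some v) :
    ∀ (E : Expr V) (v : ℤ), E.eval env = some v → E.eval env' = some v
  | .const _, _, hv => hv
  | .var x, v, hv => h x v hv
  | .add E E', v, hv => by
    simp only [Expr.eval, Option.bind_eq_bind, Option.bind_eq_some_iff] at hv ⊢
    obtain ⟨a, ha, b, hb, hv⟩ := hv
    exact ⟨a, Expr.eval_mono h E a ha, b, Expr.eval_mono h E' b hb, hv⟩
  | .mul E E', v, hv => by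
    simp only [Expr.eval, Option.bind_eq_bind, Option.bind_eq_some_iff] at hv ⊢
    obtain ⟨a, ha, b, hb, hv⟩ := hv
    exact ⟨a, Expr.eval_mono h E a ha, b, Expr.eval_mono h E' b hb, hv⟩

theorem BExpr.eval_mono (h : ∀ x v, env x = some v → env' x = some v) :
    ∀ (B : BExpr V) (b : Bool), B.eval env = some b → B.eval env' = some b
  | .tru, _, hv => hv
  | .fls, _, hv => hv
  | .and B B', v, hv => by
    simp only [BExpr.eval, Option.bind_eq_bind, Option.bind_eq_some_iff] at hv ⊢
    obtain ⟨a, ha, b, hb, hv⟩ := hv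
    exact ⟨a, BExpr.eval_mono h B a ha, b, BExpr.eval_mono h B' b hb, hv⟩
  | .or B B', v, hv => by
    simp only [BExpr.eval, Option.bind_eq_bind, Option.bind_eq_some_iff] at hv ⊢
    obtain ⟨a, ha, b, hb, hv⟩ := hv
    exact ⟨a, BExpr.eval_mono h B a ha, b, BExpr.eval_mono h B' b hb, hv⟩
  | .eq E E', v, hv => by
    simp only [BExpr.eval, Option.bind_eq_bind, Option.bind_eq_some_iff] at hv ⊢
    obtain ⟨a, ha, b, hb, hv⟩ := hv
    exact ⟨a, Expr.eval_mono h E a ha, b, Expr.eval_mono h E' b hb, hv⟩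

theorem Expr.eval_rename (env : W → Option ℤ) (f : V → W) (E : Expr V) :
    (E.rename f).eval env = E.eval (env ∘ f) := by
  induction E <;> simp_all [Expr.rename, Expr.eval]

end Eval

section LEval

variable {Var Perm : Type*}

@[simp] theorem Expr.eval_prog (ρ : LVar → ℤ) (σ : LState Var Perm) (E : Expr Var) :
    E.prog.eval (σ.env ρ) = E.eval σ.forget.stack :=
  Expr.eval_rename _ _ E

@[simp] theorem Expr.eval_logical (ρ : LVar → ℤ) (σ : LState Var Perm) (E : Expr LVar) :
    (E.logical : LExpr Var).eval (σ.env ρ) = E.eval fun X => some (ρ X) :=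
  Expr.eval_rename _ _ E

variable [PermMonoid Perm]

theorem forget_stack_mono {σ τ : LState Var Perm} {g : Resource Var Perm}
    (h : σ.cells = τ.cells * g) (x : Var) (v : ℤ) (hx : τ.forget.stack x = some v) :
    σ.forget.stack x = some v := by
  simp only [LState.forget_stack, Option.map_eq_some_iff, Prod.exists] at hx ⊢
  obtain ⟨_, p, hx, rfl⟩ := hx
  obtain ⟨q, hq⟩ := stack_of_cells_eq_mul h hx
  exact ⟨_, q, hq, rfl⟩

theorem Expr.eval_of_cells_eq_mul {σ τ : LState Var Perm} {g : Resource Var Perm}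
    (h : σ.cells = τ.cells * g) {E : Expr Var} {v : ℤ} (hE : E.eval τ.forget.stack = some v) :
    E.eval σ.forget.stack = some v :=
  Expr.eval_mono (forget_stack_mono h) E v hE

theorem BExpr.eval_of_cells_eq_mul {σ τ : LState Var Perm} {g : Resource Var Perm}
    (h : σ.cells = τ.cells * g) {B : BExpr Var} {b : Bool}
    (hB : B.eval τ.forget.stack = some b) : B.eval σ.forget.stack = some b :=
  BExpr.eval_mono (forget_stack_mono h) B b hB

theorem BExpr.sat_formula (ρ : LVar → ℤ) (σ : LState Var Perm) :
    ∀ (B : BExpr Var) (b : Bool), B.eval σ.forget.stack = some b →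
      (Sat ρ σ B.formula ↔ b = true)
  | .tru, b, h => by
    simp only [BExpr.eval, Option.some.injEq] at h
    simp [BExpr.formula, Sat, ← h]
  | .fls, b, h => by
    simp only [BExpr.eval, Option.some.injEq] at h
    simp [BExpr.formula, Sat, ← h]
  | .and B B', b, h => by
    simp only [BExpr.eval, Option.bind_eq_bind, Option.bind_eq_some_iff] at h
    obtain ⟨c, hc, d, hd, h⟩ := h
    cases h
    simp [BExpr.formula, Sat, BExpr.sat_formula ρ σ B c hc, BExpr.sat_formula ρ σ B' d hd]
  | .or B B', b, h => by
    simp only [BExpr.eval, Option.bind_eq_bind, Option.bind_eq_some_iff] at h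
    obtain ⟨c, hc, d, hd, h⟩ := h
    cases h
    simp [BExpr.formula, Sat, BExpr.sat_formula ρ σ B c hc, BExpr.sat_formula ρ σ B' d hd]
  | .eq E E', b, h => by
    simp only [BExpr.eval, Option.bind_eq_bind, Option.bind_eq_some_iff] at h
    obtain ⟨c, hc, d, hd, h⟩ := h
    cases h
    simp [BExpr.formula, Sat, hc, hd, eq_comm]

end LEval

/-! ### Resource invariants -/

section

variable {Var Lock Perm : Type*}

open Classical in
/-- The part of a context which concerns the unlocked resources, when `L` is the set of locked
resources. -/
noncomputable def Ctx.avail (Γ : Ctx Var Lock Perm) (L : Set Lock) : Ctx Var Lock Perm :=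
  fun r => if r ∈ L then none else Γ r

section

variable {Γ : Ctx Var Lock Perm}

theorem Ctx.avail_insert {r : Lock} (hr : Γ r = none) (L : Set Lock) :
    Γ.avail (insert r L) = Γ.avail L := by
  funext q
  by_cases h : q = r
  · subst h; simp [Ctx.avail, hr]
  · unfold Ctx.avail
    congr 1
    simp [h]

theorem Ctx.avail_diff {r : Lock} (hr : Γ r = none) (L : Set Lock) :
    Γ.avail (L \ {r}) = Γ.avail L := by
  funext q
  by_cases h : q = r
  · subst h; simp [Ctx.avail, hr]
  · unfold Ctx.avail
    congr 1
    simp [h]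

theorem Ctx.avail_update_of_mem [DecidableEq Lock] {r : Lock} {L : Set Lock} (hL : r ∈ L)
    (o : Option (Formula Var Perm)) : Ctx.avail (Function.update Γ r o) L = Γ.avail L := by
  funext q
  by_cases h : q = r
  · subst h; simp [Ctx.avail, hL]
  · simp [Ctx.avail, h]

end

variable [PermMonoid Perm]

/-- The resource `a` is a logical state which satisfies `P`. -/
def Holds (ρ : LVar → ℤ) (P : Formula Var Perm) (a : Resource Var Perm) : Prop :=
  ∃ σ : LState Var Perm, σ.cells = a ∧ Sat ρ σ P

/-- The resource `a` is a logical state: no cell is the outcome of an undefined product. -/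
def IsState (a : Resource Var Perm) : Prop :=
  ∃ σ : LState Var Perm, σ.cells = a

theorem IsState.of_eq_mul {a b : Resource Var Perm} {σ : LState Var Perm} (h : σ.cells = a * b) :
    IsState a :=
  exists_cells_eq h

theorem holds_cells {ρ : LVar → ℤ} {P : Formula Var Perm} {σ : LState Var Perm} :
    Holds ρ P σ.cells ↔ Sat ρ σ P := by
  constructor
  · rintro ⟨τ, h, hP⟩
    rwa [← LState.cells_injective h]
  · exact fun h => ⟨σ, rfl, h⟩

theorem holds_star {ρ : LVar → ℤ} {P Q : Formula Var Perm} {a : Resource Var Perm} :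
    Holds ρ (.star P Q) a ↔
      IsState a ∧ ∃ b c, a = b * c ∧ Holds ρ P b ∧ Holds ρ Q c := by
  constructor
  · rintro ⟨σ, rfl, σ₁, σ₂, h, h1, h2⟩
    exact ⟨⟨σ, rfl⟩, _, _, (isSep_iff _ _ _).1 h, ⟨σ₁, rfl, h1⟩, ⟨σ₂, rfl, h2⟩⟩
  · rintro ⟨⟨σ, rfl⟩, _, _, h, ⟨σ₁, rfl, h1⟩, ⟨σ₂, rfl, h2⟩⟩
    exact ⟨σ, rfl, σ₁, σ₂, (isSep_iff _ _ _).2 h, h1, h2⟩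

/-- The resource `a` is the separation product of logical states that satisfy the formulas
of `K`. Only finitely many of these states may be nonempty, so that the product is never the junk
value of `finprod`. -/
def Inv (ρ : LVar → ℤ) (K : Ctx Var Lock Perm) (a : Resource Var Perm) : Prop :=
  ∃ I : Lock → Resource Var Perm, I.mulSupport.Finite ∧ (∀ r, K r = none → I r = 1) ∧
    (∀ r J, K r = some J → Holds ρ J (I r)) ∧ a = ∏ᶠ r, I r

theorem finprod_eq_mul_finprod_update {ι M : Type*} [DecidableEq ι] [CommMonoid M] {f : ι → M}
    (hf : f.mulSupport.Finite) (i : ι) :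
    ∏ᶠ j, f j = f i * ∏ᶠ j, Function.update f i 1 j := by
  have h1 : f = fun j => (Pi.mulSingle i (f i) : ι → M) j * Function.update f i 1 j := by
    funext j
    by_cases h : j = i
    · subst h; simp
    · simp [h]
  have h2 : (Function.mulSupport (Pi.mulSingle i (f i))).Finite :=
    (Set.finite_singleton i).subset Pi.mulSupport_mulSingle_subset
  have h3 : (Function.mulSupport (Function.update f i 1)).Finite := by
    refine hf.subset fun j hj => ?_
    by_cases h : j = i
    · subst h; simp at hj
    · simpa [h] using hj
  conv_lhs => rw [h1]
  rw [finprod_mul_distrib h2 h3, finprod_eq_single _ i fun j hj => by simp [hj]]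
  simp

variable {ρ : LVar → ℤ} {Γ K : Ctx Var Lock Perm}

theorem inv_empty_iff {a : Resource Var Perm} :
    Inv ρ (Ctx.empty : Ctx Var Lock Perm) a ↔ a = 1 := by
  constructor
  · rintro ⟨I, -, h, -, rfl⟩
    simp [h _ rfl]
  · rintro rfl
    exact ⟨fun _ => 1, by simp, fun _ _ => rfl, fun r J h => by simp [Ctx.empty] at h, by simp⟩

theorem inv_iff_of_some [DecidableEq Lock] {r : Lock} {J : Formula Var Perm} (hr : K r = some J)
    {a : Resource Var Perm} :
    Inv ρ K a ↔ ∃ b c, a = b * c ∧ Holds ρ J b ∧ Inv ρ (Function.update K r none) c := by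
  constructor
  · rintro ⟨I, hf, hn, hs, rfl⟩
    refine ⟨_, _, finprod_eq_mul_finprod_update hf r, hs r J hr, _, ?_, ?_, ?_, rfl⟩
    · refine hf.subset fun j hj => ?_
      by_cases h : j = r
      · subst h; simp at hj
      · simpa [h] using hj
    · intro q hq
      by_cases h : q = r
      · subst h; simp
      · simp only [Function.update_of_ne h] at hq ⊢
        exact hn q hq
    · intro q J' hq
      by_cases h : q = r
      · subst h; simp at hq
      · simp only [Function.update_of_ne h] at hq ⊢
        exact hs q J' hq
  · rintro ⟨b, _, rfl, hb, I, hf, hn, hs, rfl⟩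
    have h1 : Function.update (Function.update I r b) r 1 = I := by
      rw [Function.update_idem, ← hn r (by simp), Function.update_eq_self]
    have hf' : (Function.mulSupport (Function.update I r b)).Finite := by
      refine (hf.insert r).subset fun j hj => ?_
      by_cases h : j = r
      · exact .inl h
      · right
        simpa [h] using hj
    refine ⟨Function.update I r b, hf', ?_, ?_, ?_⟩
    · intro q hq
      have h : q ≠ r := by rintro rfl; simp [hr] at hq
      simpa [h] using hn q (by simpa [h] using hq)
    · intro q J' hq
      by_cases h : q = r
      · subst h
        obtain rfl : J = J' := by simpa [hr] using hq
        simpa using hb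
      · simpa [h] using hs q J' (by simpa [h] using hq)
    · rw [finprod_eq_mul_finprod_update hf' r, h1]
      simp

/-- The product of precise invariants is precise. -/
theorem Inv.eq_of_precise (hK : ∀ r J, K r = some J → Precise J) {a b x y : Resource Var Perm}
    {σ : LState Var Perm} (ha : Inv ρ K a) (hb : Inv ρ K b) (hx : σ.cells = a * x)
    (hy : σ.cells = b * y) : a = b := by
  classical
  obtain ⟨I, hf, hn, hs, rfl⟩ := ha
  obtain ⟨I', hf', hn', hs', rfl⟩ := hb
  refine finprod_congr fun r => ?_
  cases hr : K r with
  | none => rw [hn r hr, hn' r hr]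
  | some J =>
    obtain ⟨τ, hτ, hJ⟩ := hs r J hr
    obtain ⟨τ', hτ', hJ'⟩ := hs' r J hr
    rw [finprod_eq_mul_finprod_update hf r, mul_assoc, ← hτ] at hx
    rw [finprod_eq_mul_finprod_update hf' r, mul_assoc, ← hτ'] at hy
    obtain ⟨υ, hυ⟩ := exists_cells_eq (hx.trans (mul_comm _ _))
    obtain ⟨υ', hυ'⟩ := exists_cells_eq (hy.trans (mul_comm _ _))
    rw [← hτ, ← hτ', hK r J hr ρ σ τ τ' ⟨υ, (isSep_iff _ _ _).2 (by rw [hx, hυ])⟩ hJ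
      ⟨υ', (isSep_iff _ _ _).2 (by rw [hy, hυ'])⟩ hJ']

theorem inv_avail_update [DecidableEq Lock] {r : Lock} {L : Set Lock} (hr : Γ r = none) (hL : r ∉ L)
    {J : Formula Var Perm} {a : Resource Var Perm} :
    Inv ρ (Ctx.avail (Function.update Γ r (some J)) L) a ↔
      ∃ b c, a = b * c ∧ Holds ρ J b ∧ Inv ρ (Γ.avail L) c := by
  rw [inv_iff_of_some (r := r) (J := J) (by simp [Ctx.avail, hL])]
  have : Function.update (Ctx.avail (Function.update Γ r (some J)) L) r none = Γ.avail L := by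
    funext q
    by_cases h : q = r
    · subst h; simp [Ctx.avail, hr]
    · simp [Ctx.avail, h]
  rw [this]

variable {H : Set Lock} {r : Lock} {J : Formula Var Perm}

/-- The resources `a` of the Code, seen from outside of the scope of a private lock `r`: they
include the invariant of `r` as long as `r` is not held. -/
def WithInv (ρ : LVar → ℤ) (r : Lock) (J : Formula Var Perm) (H : Set Lock)
    (a a' : Resource Var Perm) : Prop :=
  (r ∈ H ∧ a' = a) ∨ (r ∉ H ∧ ∃ j, Holds ρ J j ∧ a' = a * j)

theorem WithInv.exists_inv [DecidableEq Lock] (hr : Γ r = none) {L : Set Lock} (hL : r ∈ H ↔ r ∈ L)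
    {a' i : Resource Var Perm} (h : WithInv ρ r J H a a') (hi : Inv ρ (Γ.avail L) i) :
    ∃ i', Inv ρ (Ctx.avail (Function.update Γ r (some J)) L) i' ∧ a' * i = a * i' := by
  rcases h with ⟨h, rfl⟩ | ⟨h, j, hj, rfl⟩
  · rw [Ctx.avail_update_of_mem (hL.1 h)]
    exact ⟨i, hi, rfl⟩
  · exact ⟨j * i, (inv_avail_update hr (mt hL.2 h)).2 ⟨j, i, rfl, hj, hi⟩, mul_assoc _ _ _⟩

theorem Inv.exists_withInv [DecidableEq Lock] (hr : Γ r = none) {L : Set Lock} (hL : r ∈ H ↔ r ∈ L)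
    {i : Resource Var Perm} (hi : Inv ρ (Ctx.avail (Function.update Γ r (some J)) L) i)
    (a : Resource Var Perm) :
    ∃ a' i', WithInv ρ r J H a a' ∧ Inv ρ (Γ.avail L) i' ∧ a * i = a' * i' := by
  by_cases h : r ∈ L
  · rw [Ctx.avail_update_of_mem h] at hi
    exact ⟨a, i, .inl ⟨hL.2 h, rfl⟩, hi, rfl⟩
  · obtain ⟨j, i', rfl, hj, hi'⟩ := (inv_avail_update hr h).1 hi
    exact ⟨a * j, i', .inr ⟨mt hL.1 h, j, hj, rfl⟩, hi', (mul_assoc _ _ _).symm⟩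

/-! ### Safe executions -/

section

variable {Var Lock : Type*}

/-- The effect of an instruction on the set of resources held by the Code. -/
def Instr.held : Instr Var Lock → Set Lock → Set Lock
  | .P r, H => insert r H
  | .V r, H => H \ {r}
  | _, H => H

theorem Instr.held_hide (r : Lock) (m : Instr Var Lock) (H : Set Lock) :
    (m.hide r).held (H \ {r}) = m.held H \ {r} := by
  cases m with
  | P q =>
    by_cases h : q = r
    · subst h
      simp [Instr.hide, Instr.held]
    · rw [show Instr.hide r (.P q : Instr Var Lock) = .P q by simp [Instr.hide, h]]
      exact (Set.insert_sdiff_of_notMem _ (Set.notMem_singleton_iff.2 h)).symm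
  | V q =>
    by_cases h : q = r
    · subst h
      simp [Instr.hide, Instr.held]
    · rw [show Instr.hide r (.V q : Instr Var Lock) = .V q by simp [Instr.hide, h]]
      exact sdiff_sdiff_comm
  | _ => simp [Instr.hide, Instr.held]

theorem Returns.locks_eq [DecidableEq Var] {m : Instr Var Lock} {s s' : MState Var Lock}
    (h : Returns m s s') : s'.locks = m.held s.locks := by
  cases m with
  | P r => rw [h.2]; rfl
  | V r => rw [h.2]; rfl
  | nop => rw [show s' = s from h]; rfl
  | assign x E => obtain ⟨v, -, rfl⟩ := h; rfl
  | load x E => obtain ⟨l, v, -, -, rfl⟩ := h; rfl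
  | store E E' => obtain ⟨l, v, -, -, -, rfl⟩ := h; rfl
  | alloc x E => obtain ⟨l, v, -, -, rfl⟩ := h; rfl
  | dispose E => obtain ⟨l, -, -, rfl⟩ := h; rfl

end

variable [DecidableEq Var]

/-- The Code, which owns the resource `a` and holds the locks in `H`, can safely take the
transition `c` and then satisfies `S`: whenever the state before `c` splits into `a`, the
invariants `i` of the unlocked resources and some frame `f`, the transition succeeds, it releases
only locks held by the Code, and the frame is preserved.

The logical state of the whole system after `c` is required to be `σ.lift c.tgt.mem`: it is
determined by the machine step, as the conjunction rule demands. -/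
def SafeStep (Γ : Ctx Var Lock Perm) (ρ : LVar → ℤ) (c : CodeStep Var Lock)
    (S : Set Lock → Resource Var Perm → Prop) (H : Set Lock) (a : Resource Var Perm) : Prop :=
  ∀ (i f : Resource Var Perm) (σ : LState Var Perm), σ.forget = c.src.mem → H ⊆ c.src.locks →
    Inv ρ (Γ.avail c.src.locks) i → σ.cells = a * i * f →
      Returns c.instr c.src c.tgt ∧ (∀ r, c.instr = .V r → r ∈ H) ∧
        ∃ a' i', Inv ρ (Γ.avail c.tgt.locks) i' ∧ (σ.lift c.tgt.mem).cells = a' * i' * f ∧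
          S (c.instr.held H) a'

/-- The Code can safely take a sequence of transitions, and satisfies `R` at the end. Between two
transitions, the Environment may change the invariants and the frame. -/
def Safe (Γ : Ctx Var Lock Perm) (ρ : LVar → ℤ) (R : Set Lock → Resource Var Perm → Prop) :
    List (CodeStep Var Lock) → Set Lock → Resource Var Perm → Prop
  | [] => R
  | c :: l => SafeStep Γ ρ c (Safe Γ ρ R l)

variable {R R' S S' : Set Lock → Resource Var Perm → Prop}
  {a : Resource Var Perm} {c : CodeStep Var Lock} {l l' : List (CodeStep Var Lock)}

theorem SafeStep.mono (h : SafeStep Γ ρ c S H a) (hS : ∀ H a, S H a → S' H a) :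
    SafeStep Γ ρ c S' H a := by
  intro i f σ h1 h2 h3 h4
  obtain ⟨h5, h6, a', i', h7, h8, h9⟩ := h i f σ h1 h2 h3 h4
  exact ⟨h5, h6, a', i', h7, h8, hS _ _ h9⟩

theorem Safe.mono (h : Safe Γ ρ R l H a) (hR : ∀ H a, R H a → R' H a) : Safe Γ ρ R' l H a := by
  induction l generalizing H a with
  | nil => exact hR _ _ h
  | cons c l ih => exact SafeStep.mono h fun _ _ h => ih h

theorem Safe.append (h : Safe Γ ρ R l H a) (hR : ∀ H a, R H a → Safe Γ ρ R' l' H a) :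
    Safe Γ ρ R' (l ++ l') H a := by
  induction l generalizing H a with
  | nil => exact hR _ _ h
  | cons c l ih => exact SafeStep.mono h fun _ _ h => ih h

theorem SafeStep.frame {H₂ : Set Lock} {b : Resource Var Perm} (h : SafeStep Γ ρ c S H a)
    (hd : Disjoint H H₂) :
    SafeStep Γ ρ c (fun H' a' => ∃ H₁ a₁, H' = H₁ ∪ H₂ ∧ Disjoint H₁ H₂ ∧ a' = a₁ * b ∧
      IsState a' ∧ S H₁ a₁) (H ∪ H₂) (a * b) := by
  intro i f σ h1 h2 h3 h4
  obtain ⟨h5, h6, a', i', h7, h8, h9⟩ := h i (b * f) σ h1 (Set.subset_union_left.trans h2) h3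
    (by rw [h4]; ac_rfl)
  have h10 : (σ.lift c.tgt.mem).cells = a' * b * i' * f := by rw [h8]; ac_rfl
  refine ⟨h5, fun r hr => .inl (h6 r hr), a' * b, i', h7, h10, c.instr.held H, a', ?_, ?_, rfl,
    .of_eq_mul (h10.trans (mul_assoc _ _ _)), h9⟩
  · cases hm : c.instr <;> simp only [Instr.held]
    · exact Set.insert_union.symm ▸ rfl
    · rename_i r
      have hr : r ∉ H₂ := fun hr => hd.le_bot ⟨h6 r hm, hr⟩
      ext q
      simp only [Set.mem_sdiff, Set.mem_union, Set.mem_singleton_iff]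
      grind
  · cases hm : c.instr <;> simp only [Instr.held] <;> try exact hd
    · rename_i r
      rw [hm] at h5
      rw [Set.disjoint_insert_left]
      exact ⟨fun hr => h5.1 (h2 (.inr hr)), hd⟩
    · exact hd.mono_left Set.sdiff_subset

theorem Safe.frame {b : Resource Var Perm} (h : Safe Γ ρ R l H a) (hs : IsState (a * b)) :
    Safe Γ ρ (fun H a' => ∃ a₁, a' = a₁ * b ∧ IsState a' ∧ R H a₁) l H (a * b) := by
  induction l generalizing H a with
  | nil => exact ⟨a, rfl, hs, h⟩
  | cons c l ih =>
    have := SafeStep.frame (b := b) h (Set.disjoint_empty H)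
    rw [Set.union_empty] at this
    refine SafeStep.mono this ?_
    rintro H' a' ⟨H₁, a₁, rfl, -, rfl, hs, h⟩
    rw [Set.union_empty]
    exact ih h hs

theorem Safe.par {l₁ l₂ : List (CodeStep Var Lock)} {R₁ R₂ : Set Lock → Resource Var Perm → Prop}
    {H₁ H₂ : Set Lock} {a₁ a₂ : Resource Var Perm} (hl : Shuffle l₁ l₂ l)
    (h₁ : Safe Γ ρ R₁ l₁ H₁ a₁) (h₂ : Safe Γ ρ R₂ l₂ H₂ a₂) (hd : Disjoint H₁ H₂)
    (hs : IsState (a₁ * a₂)) :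
    Safe Γ ρ (fun H a => ∃ H₁ H₂ a₁ a₂, H = H₁ ∪ H₂ ∧ a = a₁ * a₂ ∧ IsState a ∧ R₁ H₁ a₁ ∧
      R₂ H₂ a₂) l (H₁ ∪ H₂) (a₁ * a₂) := by
  induction hl generalizing H₁ H₂ a₁ a₂ with
  | nil => exact ⟨H₁, H₂, a₁, a₂, rfl, rfl, hs, h₁, h₂⟩
  | left c _ ih =>
    refine (SafeStep.frame (b := a₂) h₁ hd).mono ?_
    rintro _ _ ⟨H', a', rfl, hd, rfl, hs, h⟩
    exact ih h h₂ hd hs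
  | right c _ ih =>
    rw [Set.union_comm, mul_comm]
    refine (SafeStep.frame (b := a₁) h₂ hd.symm).mono ?_
    rintro _ _ ⟨H', a', rfl, hd, rfl, hs, h⟩
    rw [mul_comm] at hs
    rw [Set.union_comm, mul_comm]
    exact ih h₁ h hd.symm hs

/-- Two proofs about the same execution give the same ownership to the Code, because the
invariants are precise and the separation product is cancellative. -/
theorem Safe.and (hΓ : ∀ r J, Γ r = some J → Precise J) (h : Safe Γ ρ R l H a)
    (h' : Safe Γ ρ R' l H a) : Safe Γ ρ (fun H a => R H a ∧ R' H a) l H a := by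
  induction l generalizing H a with
  | nil => exact ⟨h, h'⟩
  | cons c l ih =>
    intro i f σ h1 h2 h3 h4
    obtain ⟨h5, h6, a', i', h7, h8, h9⟩ := h i f σ h1 h2 h3 h4
    obtain ⟨-, -, a'', i'', h7', h8', h9'⟩ := h' i f σ h1 h2 h3 h4
    have hp : ∀ r J, Γ.avail c.tgt.locks r = some J → Precise J := fun r J hr => by
      unfold Ctx.avail at hr
      split_ifs at hr
      exact hΓ r J hr
    obtain rfl := h7.eq_of_precise hp h7' (x := a' * f) (y := a'' * f)
      (by rw [h8]; ac_rfl) (by rw [h8']; ac_rfl)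
    obtain rfl := cells_mul_right_cancel (h8.trans (mul_assoc _ _ _))
      (h8'.trans (mul_assoc _ _ _))
    exact ⟨h5, h6, a', i', h7, h8, ih h9 h9'⟩

/-- While the Code holds `r`, the invariant of `r` plays no role. -/
theorem Safe.critical [DecidableEq Lock] (h : Safe Γ ρ R l H a) (hH : r ∉ H) :
    Safe (Function.update Γ r (some J)) ρ (fun H' a => ∃ H, H' = insert r H ∧ R H a) l
      (insert r H) a := by
  induction l generalizing H a with
  | nil => exact ⟨H, rfl, h⟩
  | cons c l ih =>
    intro i f σ h1 h2 h3 h4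
    have hs : r ∈ c.src.locks := h2 (.inl rfl)
    rw [Ctx.avail_update_of_mem hs] at h3
    obtain ⟨h5, h6, a', i', h7, h8, h9⟩ := h i f σ h1 (fun q hq => h2 (.inr hq)) h3 h4
    have key : c.instr.held (insert r H) = insert r (c.instr.held H) ∧ r ∉ c.instr.held H ∧
        r ∈ c.tgt.locks := by
      rw [h5.locks_eq]
      cases hm : c.instr with
      | P q =>
        rw [hm] at h5
        have hq : r ≠ q := by rintro rfl; exact h5.1 hs
        exact ⟨Set.insert_comm _ _ _, fun h => h.elim hq hH, .inr hs⟩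
      | V q =>
        have hq : r ≠ q := by rintro rfl; exact hH (h6 r hm)
        exact ⟨Set.insert_sdiff_of_notMem _ hq, fun h => hH h.1, hs, hq⟩
      | _ => exact ⟨rfl, hH, hs⟩
    refine ⟨h5, fun q hq => .inr (h6 q hq), a', i', ?_, h8, ?_⟩
    · rwa [Ctx.avail_update_of_mem key.2.2]
    · rw [key.1]
      exact ih h9 key.2.1

/-- An execution in the scope of a private lock `r`, seen from outside. Since only the Code
locks and releases `r`, the resource `r` is locked exactly when the Code holds it. -/
theorem Safe.hide [DecidableEq Lock] (hr : Γ r = none) (h : Safe (Function.update Γ r (some J)) ρ R l H a)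
    {s t : MState Var Lock} (hs : r ∈ s.locks ↔ r ∈ H)
    (hp : ∀ e ∈ (s :: l.map CodeStep.tgt).zip (l.map CodeStep.src ++ [t]),
      (r ∈ e.1.locks ↔ r ∈ e.2.locks))
    {a' : Resource Var Perm} (ha : WithInv ρ r J H a a') (hst : IsState a') :
    Safe Γ ρ (fun H' a' => ∃ H a, H' = H \ {r} ∧ WithInv ρ r J H a a' ∧ IsState a' ∧ R H a)
      (l.map fun c => ⟨c.src.hide r, c.instr.hide r, c.tgt.hide r⟩) (H \ {r}) a' := by
  induction l generalizing H a a' s with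
  | nil => exact ⟨H, a, rfl, ha, hst, h⟩
  | cons c l ih =>
    simp only [List.map_cons, List.cons_append, List.zip_cons_cons, List.forall_mem_cons] at hp
    obtain ⟨hp1, hp2⟩ := hp
    have hsrc : r ∈ H ↔ r ∈ c.src.locks := hs.symm.trans hp1
    intro i f σ h1 h2 h3 h4
    simp only [MState.hide] at h1 h2 h3 ⊢
    rw [Ctx.avail_diff hr] at h3
    obtain ⟨i₀, hi₀, e₀⟩ := ha.exists_inv hr hsrc h3
    have hsub : H ⊆ c.src.locks := fun q hq => by
      by_cases h : q = r
      · subst h; exact hsrc.1 hq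
      · exact (h2 ⟨hq, h⟩).1
    obtain ⟨h5, h6, a₁, i₁, h7, h8, h9⟩ := h i₀ f σ h1 hsub hi₀ (by rw [h4, e₀])
    have htgt : r ∈ c.instr.held H ↔ r ∈ c.tgt.locks := by
      rw [h5.locks_eq]
      cases c.instr <;> simp only [Instr.held] <;> try exact hsrc
      · simp [hsrc]
      · simp [hsrc]
    obtain ⟨a₂, i₂, hw, hi₂, e₂⟩ := h7.exists_withInv hr htgt a₁
    rw [e₂] at h8
    refine ⟨h5.hide r, ?_, a₂, i₂, ?_, h8, ?_⟩
    · intro q hq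
      unfold Instr.hide at hq
      split_ifs at hq with hc
      exact ⟨h6 q hq, by rintro rfl; exact hc (.inr hq)⟩
    · rwa [Ctx.avail_diff hr]
    · rw [Instr.held_hide]
      exact ih h9 htgt.symm hp2 hw (.of_eq_mul (h8.trans (mul_assoc _ _ _)))

end

/-! ### Instructions -/

section

variable {Var Lock Perm : Type*} [PermMonoid Perm]

@[simp] theorem FinPFun.set_apply {α β : Type*} [DecidableEq α] (f : FinPFun α β) (a : α)
    (b : Option β) (c : α) : f.set a b c = Function.update f.toFun a b c := rfl

/-- A step of the Code to the memory `μ` turns the part `τ` of `σ` into `τ'`, and preserves the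
frame `g`, when it modifies only variables and locations of which `g` has no part. -/
theorem cells_lift_eq_mul {σ τ τ' : LState Var Perm} {g : Resource Var Perm} {μ : MemState Var}
    (h : σ.cells = τ.cells * g)
    (hs : ∀ x, (μ.stack x = σ.forget.stack x ∧ τ'.stack x = τ.stack x) ∨
      (g (.inl x) = 1 ∧ (σ.lift μ).stack x = τ'.stack x))
    (hh : ∀ l, (μ.heap l = σ.forget.heap l ∧ τ'.heap l = τ.heap l) ∨
      (g (.inr l) = 1 ∧ (σ.lift μ).heap l = τ'.heap l)) :
    (σ.lift μ).cells = τ'.cells * g := by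
  refine cells_eq_mul_of_local h ?_
  rintro (x | l)
  · exact (hs x).imp
      (fun h => ⟨congrArg Cell.ofOption (LState.lift_stack_of_eq h.1), congrArg Cell.ofOption h.2⟩)
      (fun h => ⟨h.1, congrArg Cell.ofOption h.2⟩)
  · exact (hh l).imp
      (fun h => ⟨congrArg Cell.ofOption (LState.lift_heap_of_eq h.1), congrArg Cell.ofOption h.2⟩)
      (fun h => ⟨h.1, congrArg Cell.ofOption h.2⟩)

variable [DecidableEq Var] {σ τ : LState Var Perm} {g : Resource Var Perm}

theorem cells_lift_set_stack (h : σ.cells = τ.cells * g) {x : Var} {v : ℤ}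
    (hx : τ.stack x = some (v, PermMonoid.top)) (w : ℤ) :
    (σ.lift ⟨σ.forget.stack.set x (some w), σ.forget.heap⟩).cells =
      (⟨τ.stack.set x (some (w, PermMonoid.top)), τ.heap⟩ : LState Var Perm).cells * g := by
  refine cells_lift_eq_mul h (fun y => ?_) fun l => .inl ⟨rfl, rfl⟩
  by_cases hy : y = x
  · subst hy
    exact .inr ⟨frame_stack_eq_one h hx, by simp [stack_eq_of_top h hx]⟩
  · exact .inl (by simp [hy])

omit [DecidableEq Var] in
theorem cells_lift_set_heap (h : σ.cells = τ.cells * g) {l : ℕ} {v : ℤ}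
    (hl : τ.heap l = some (v, PermMonoid.top)) (o : Option ℤ) :
    (σ.lift ⟨σ.forget.stack, σ.forget.heap.set l o⟩).cells =
      (⟨τ.stack, τ.heap.set l (o.map fun w => (w, PermMonoid.top))⟩ : LState Var Perm).cells *
        g := by
  refine cells_lift_eq_mul h (fun y => .inl ⟨rfl, rfl⟩) fun k => ?_
  by_cases hk : k = l
  · subst hk
    exact .inr ⟨frame_heap_eq_one h hl, by simp [heap_eq_of_top h hl]⟩
  · exact .inl (by simp [hk])

/-- Local specification of an instruction: in a memory which splits into a part satisfying `P`
and a frame, `m` executes successfully, preserves the frame, and leads to a part satisfying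
`Q`. -/
def LocalSpec (P : Formula Var Perm) (m : Instr Var Lock) (Q : Formula Var Perm) : Prop :=
  ∀ (ρ : LVar → ℤ) (τ σ : LState Var Perm) (g : Resource Var Perm) (L : Set Lock), Sat ρ τ P →
    σ.cells = τ.cells * g →
      (∃ s', Returns m ⟨σ.forget, L⟩ s') ∧
        ∀ s', Returns m ⟨σ.forget, L⟩ s' →
          ∃ a', Holds ρ Q a' ∧ (σ.lift s'.mem).cells = a' * g

theorem localSpec_nop (P : Formula Var Perm) :
    LocalSpec P (.nop : Instr Var Lock) P := by
  intro ρ τ σ g L hP h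
  refine ⟨⟨_, rfl⟩, ?_⟩
  rintro _ rfl
  exact ⟨τ.cells, ⟨τ, rfl, hP⟩, by rw [LState.lift_forget, h]⟩

theorem localSpec_assign (x : Var) (E : Expr Var) (X : Expr LVar) :
    LocalSpec (Perm := Perm) (.and (.own PermMonoid.top x) (.eq X.logical E.prog))
      (.assign x E : Instr Var Lock)
      (.and (.own PermMonoid.top x) (.eq (.var (.inl x)) X.logical)) := by
  rintro ρ τ σ g L ⟨⟨v₀, hx⟩, v, hX, hE⟩ h
  simp only [Expr.eval_prog, Expr.eval_logical] at hX hE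
  have hE' := Expr.eval_of_cells_eq_mul h hE
  refine ⟨⟨_, v, hE', rfl⟩, ?_⟩
  rintro s' ⟨w, hw, rfl⟩
  obtain rfl : v = w := Option.some.inj (hE'.symm.trans hw)
  refine ⟨_, ⟨_, rfl, ⟨v, ?_⟩, v, ?_, ?_⟩, cells_lift_set_stack h hx v⟩
  · simp
  · simp [Expr.eval, LState.env, FinPFun.map]
  · simpa using hX

theorem localSpec_load (x : Var) (E : Expr Var) (p : Perm) (v : Expr LVar) :
    LocalSpec (.star (.pointsTo E.prog p v.logical) (.own PermMonoid.top x))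
      (.load x E : Instr Var Lock)
      (.star (.pointsTo E.prog p v.logical)
        (.and (.own PermMonoid.top x) (.eq (.var (.inl x)) v.logical))) := by
  rintro ρ τ σ g L ⟨τ₁, τ₂, hτ, hE, v₀, hx⟩ h
  have hE₀ := hE
  obtain ⟨l, n, hE, hv, hl, -⟩ := hE
  rw [(isSep_iff _ _ _).1 hτ] at h
  have h1 : σ.cells = τ₁.cells * (τ₂.cells * g) := by rw [h, mul_assoc]
  have h2 : σ.cells = τ₂.cells * (τ₁.cells * g) := by rw [h]; ac_rfl
  simp only [Expr.eval_prog, Expr.eval_logical] at hE hv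
  have hE' := Expr.eval_of_cells_eq_mul h1 hE
  obtain ⟨q, hq⟩ := heap_of_cells_eq_mul h1 hl
  have hl' : σ.forget.heap l = some n := by simp [hq]
  refine ⟨⟨_, l, n, hE', hl', rfl⟩, ?_⟩
  rintro s' ⟨k, w, hk, hw, rfl⟩
  obtain rfl : l = k := by exact_mod_cast Option.some.inj (hE'.symm.trans hk)
  obtain rfl : n = w := Option.some.inj (hl'.symm.trans hw)
  have h3 := cells_lift_set_stack h2 hx n
  rw [mul_left_comm, ← mul_assoc] at h3
  refine ⟨_, holds_star.2 ⟨.of_eq_mul h3, _, _, rfl, ⟨τ₁, rfl, hE₀⟩, _, rfl, ⟨n, ?_⟩, n, ?_, ?_⟩,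
    h3⟩
  · simp
  · simp [Expr.eval, LState.env, FinPFun.map]
  · simpa using hv

theorem localSpec_store (E E' : Expr Var) :
    LocalSpec (Perm := Perm) (.and (.pointsToAny E) (.eq E'.prog E'.prog))
      (.store E E' : Instr Var Lock) (.pointsTo E.prog PermMonoid.top E'.prog) := by
  rintro ρ τ σ g L ⟨⟨v₀, l, v₁, hE, -, hl, hl'⟩, v, hE', -⟩ h
  simp only [Expr.eval_prog] at hE hE'
  have hE₁ := Expr.eval_of_cells_eq_mul h hE
  have hE₁' := Expr.eval_of_cells_eq_mul h hE'
  refine ⟨⟨_, l, v, hE₁, by simp [heap_eq_of_top h hl], hE₁', rfl⟩, ?_⟩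
  rintro s' ⟨k, w, hk, -, hw, rfl⟩
  obtain rfl : l = k := by exact_mod_cast Option.some.inj (hE₁.symm.trans hk)
  obtain rfl : v = w := Option.some.inj (hE₁'.symm.trans hw)
  refine ⟨_, ⟨_, rfl, l, v, ?_, ?_, ?_, fun k hk => ?_⟩, cells_lift_set_heap h hl (some v)⟩
  · rw [Expr.eval_prog]; exact hE
  · rw [Expr.eval_prog]; exact hE'
  · simp
  · simpa [hk] using hl' k hk

theorem localSpec_dispose (E : Expr Var) :
    LocalSpec (Perm := Perm) (.pointsToAny E) (.dispose E : Instr Var Lock) .emp := by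
  rintro ρ τ σ g L ⟨v₀, l, v₁, hE, -, hl, hl'⟩ h
  simp only [Expr.eval_prog] at hE
  have hE₁ := Expr.eval_of_cells_eq_mul h hE
  refine ⟨⟨_, l, hE₁, by simp [heap_eq_of_top h hl], rfl⟩, ?_⟩
  rintro s' ⟨k, hk, -, rfl⟩
  obtain rfl : l = k := by exact_mod_cast Option.some.inj (hE₁.symm.trans hk)
  refine ⟨_, ⟨_, rfl, fun k => ?_⟩, cells_lift_set_heap h hl none⟩
  by_cases hk : k = l
  · subst hk; simp
  · simpa [hk] using hl' k hk

theorem localSpec_alloc (x : Var) (E : Expr Var) (X : Expr LVar) :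
    LocalSpec (Perm := Perm)
      (.and (.own PermMonoid.top x) (.and (.eq X.logical E.prog) .emp))
      (.alloc x E : Instr Var Lock)
      (.and (.own PermMonoid.top x)
        (.pointsTo (.var (.inl x)) PermMonoid.top X.logical)) := by
  rintro ρ τ σ g L ⟨⟨v₀, hx⟩, ⟨v, hX, hE⟩, hemp⟩ h
  simp only [Expr.eval_prog, Expr.eval_logical] at hX hE
  have hE' := Expr.eval_of_cells_eq_mul h hE
  constructor
  · obtain ⟨l, hl⟩ := σ.forget.heap.finite_dom.exists_notMem
    exact ⟨_, l, v, hE', not_not.1 hl, rfl⟩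
  rintro s' ⟨l, w, hw, hl, rfl⟩
  obtain rfl : v = w := Option.some.inj (hE'.symm.trans hw)
  have hl' : σ.heap l = none := by simpa using hl
  refine ⟨_, ⟨⟨τ.stack.set x (some ((l : ℤ), PermMonoid.top)),
    τ.heap.set l (some (v, PermMonoid.top))⟩, rfl, ⟨l, ?_⟩, l, v, ?_, ?_, ?_, fun k hk => ?_⟩,
    cells_lift_eq_mul h (fun y => ?_) fun k => ?_⟩
  · simp
  · simp [Expr.eval, LState.env, FinPFun.map]
  · simpa using hX
  · simp
  · simpa [hk] using hemp k
  · by_cases hy : y = x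
    · subst hy
      exact .inr ⟨frame_stack_eq_one h hx, by simp [stack_eq_of_top h hx]⟩
    · exact .inl (by simp [hy])
  · by_cases hk : k = l
    · subst hk
      exact .inr ⟨frame_heap_eq_one_of_none h hl', by simp [hl']⟩
    · exact .inl (by simp [hk])

end

/-! ### Valid triples -/

section

variable {Var Lock Perm : Type*} [DecidableEq Var] [PermMonoid Perm]
  {Γ : Ctx Var Lock Perm} {P P' Q Q' R : Formula Var Perm} {T T' : TransSys Var Lock}

theorem MachineStep.returns {m : Instr Var Lock} {s s' : MState Var Lock}
    (h : MachineStep m s s') (hm : ∃ s'', Returns m s s'') : Returns m s s' :=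
  h.resolve_right fun hf => hf.2.2 hm

/-- Validity of a triple: owning a part which satisfies `P`, and no lock, the Code safely executes
every trace; at the end of the traces which return, it owns a part which satisfies `Q`, and no
lock. -/
def Valid (Γ : Ctx Var Lock Perm) (P : Formula Var Perm) (T : TransSys Var Lock)
    (Q : Formula Var Perm) : Prop :=
  ∀ ρ a, Holds ρ P a →
    (∀ t ∈ T.traces, Safe Γ ρ (fun _ _ => True) t.steps ∅ a) ∧
      ∀ t ∈ T.ret, Safe Γ ρ (fun H a => H = ∅ ∧ Holds ρ Q a) t.steps ∅ a

/-- An instruction which meets its local specification is safe, when it does not operate on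
locks. -/
theorem LocalSpec.safeStep {ρ : LVar → ℤ} {m : Instr Var Lock} {s s' : MState Var Lock}
    {a : Resource Var Perm} (h : LocalSpec P m Q) (hP : ∀ r, m ≠ .P r) (hV : ∀ r, m ≠ .V r)
    (hs : MachineStep m s s') (ha : Holds ρ P a) (H : Set Lock) :
    SafeStep Γ ρ ⟨s, m, s'⟩ (fun H' a => H' = H ∧ Holds ρ Q a) H a := by
  obtain ⟨τ, rfl, ha⟩ := ha
  rintro i f σ h1 - h3 h4
  obtain ⟨_, L⟩ := s
  obtain rfl := h1
  obtain ⟨h5, h6⟩ := h ρ τ σ (i * f) L ha (by rw [h4, mul_assoc])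
  have h7 := hs.returns h5
  obtain ⟨a', h8, h9⟩ := h6 _ h7
  have hheld : ∀ H, m.held H = H := by
    intro H
    cases m <;> first | rfl | exact absurd rfl (hP _) | exact absurd rfl (hV _)
  refine ⟨h7, fun r hr => absurd hr (hV r), a', i, ?_, by rw [h9, mul_assoc], hheld H, h8⟩
  have h10 := h7.locks_eq
  rw [hheld] at h10
  simp only [h10]
  exact h3

theorem LocalSpec.valid {m : Instr Var Lock} (h : LocalSpec P m Q) (hP : ∀ r, m ≠ .P r)
    (hV : ∀ r, m ≠ .V r) : Valid Γ P (.ofInstr m) Q := by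
  intro ρ a ha
  constructor
  · rintro ⟨_, l, _, hv⟩ (rfl | ⟨s, s', rfl⟩)
    · trivial
    · exact (h.safeStep hP hV (hv _ (.head _)) ha ∅).mono fun _ _ _ => trivial
  · rintro ⟨_, l, _, hv⟩ ⟨s, s', rfl, -⟩
    exact h.safeStep hP hV (hv _ (.head _)) ha ∅

theorem Trace.codeSrc_of_steps_eq {t : Trace Var Lock} {c : CodeStep Var Lock}
    {l : List (CodeStep Var Lock)} (h : t.steps = c :: l) : t.codeSrc = c.src := by
  unfold Trace.codeSrc
  simp [h]

omit [DecidableEq Var] in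
/-- The value of a test in the memory is its value in the part owned by the Code, as soon as the
test is defined there. -/
theorem EntailsDef.eval_eq {B : BExpr Var} (hB : EntailsDef P B) {ρ : LVar → ℤ}
    {σ τ : LState Var Perm} {g : Resource Var Perm} (hP : Sat ρ τ P)
    (h : σ.cells = τ.cells * g) : B.eval σ.forget.stack = B.eval τ.forget.stack := by
  obtain ⟨b, hb⟩ := Option.ne_none_iff_exists'.1 (hB ρ τ hP)
  exact (BExpr.eval_of_cells_eq_mul h hb).trans hb.symm

theorem Valid.test {B : BExpr Var} {b : Bool} (hB : EntailsDef P B)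
    (h : ∀ ρ σ, Sat ρ σ P → B.eval σ.forget.stack = some b → Sat ρ σ Q) :
    Valid Γ P (.whenB B b (.ofInstr .nop)) Q := by
  have key : ∀ (ρ : LVar → ℤ) (a : Resource Var Perm) (s s' : MState Var Lock), Holds ρ P a →
      MachineStep .nop s s' → B.eval s.mem.stack = some b →
      SafeStep Γ ρ ⟨s, .nop, s'⟩ (fun H a => H = ∅ ∧ Holds ρ Q a) ∅ a := by
    intro ρ a s s' ha hs hb i f σ h1 h2 h3 h4
    obtain ⟨τ, rfl, hP⟩ := ha
    have hQ : Holds ρ Q τ.cells := by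
      refine ⟨τ, rfl, h ρ τ hP ?_⟩
      rw [← hB.eval_eq hP (h4.trans (mul_assoc _ _ _)), h1, hb]
    exact ((localSpec_nop P).safeStep (by simp) (by simp) hs ⟨τ, rfl, hP⟩ ∅ i f σ h1 h2 h3 h4).imp
      id fun ⟨h5, a', i', h6, h7, h8, h9⟩ => by
        obtain rfl : s' = s := hs.returns ⟨s, rfl⟩
        refine ⟨h5, τ.cells, i, h3, ?_, h8, hQ⟩
        rw [show (CodeStep.mk s' Instr.nop s').tgt.mem = σ.forget from h1.symm, LState.lift_forget,
          h4]
  intro ρ a ha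
  constructor
  · rintro t ⟨ht | ⟨s, s', ht⟩, hb⟩
    · rw [ht]
      trivial
    · rw [Trace.codeSrc_of_steps_eq ht] at hb
      have hs := t.valid ⟨s, .nop, s'⟩ (by simp [ht])
      rw [ht]
      exact (key ρ a s s' ha hs hb).mono fun _ _ _ => trivial
  · rintro t ⟨⟨s, s', ht, hs⟩, hb⟩
    rw [Trace.codeSrc_of_steps_eq ht] at hb
    rw [ht]
    exact key ρ a s s' ha (.inl hs) hb

theorem Valid.whenAbort {B : BExpr Var} (hB : EntailsDef P B) :
    Valid Γ P (.whenAbort B) Q := by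
  rintro ρ a ⟨τ, rfl, hP⟩
  refine ⟨?_, fun t ht => ht.elim⟩
  rintro t ⟨hb, ht | ⟨s, s', x, -, -, ht⟩⟩
  · rw [ht]
    trivial
  · rw [Trace.codeSrc_of_steps_eq ht] at hb
    rw [ht]
    intro i f σ h1 _ _ h4
    have h1 : σ.forget = s.mem := h1
    rw [← h1, hB.eval_eq hP (h4.trans (mul_assoc _ _ _))] at hb
    exact (hB ρ τ hP hb).elim

theorem Valid.empty : Valid Γ P .empty Q :=
  fun _ _ _ => ⟨fun _ ht => ht.elim, fun _ ht => ht.elim⟩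

theorem Valid.union (h : Valid Γ P T Q) (h' : Valid Γ P T' Q) : Valid Γ P (T.union T') Q :=
  fun ρ a ha => ⟨fun t ht => ht.elim ((h ρ a ha).1 t) ((h' ρ a ha).1 t),
    fun t ht => ht.elim ((h ρ a ha).2 t) ((h' ρ a ha).2 t)⟩

theorem Valid.iUnion {ι : Type*} {T : ι → TransSys Var Lock} (h : ∀ i, Valid Γ P (T i) Q) :
    Valid Γ P (.iUnion T) Q := by
  intro ρ a ha
  constructor <;> intro t ht <;> obtain ⟨i, hi⟩ := Set.mem_iUnion.1 ht
  · exact (h i ρ a ha).1 t hi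
  · exact (h i ρ a ha).2 t hi

theorem Valid.seq (h : Valid Γ P T R) (h' : Valid Γ R T' Q) : Valid Γ P (T.seq T') Q := by
  intro ρ a ha
  constructor
  · rintro t (ht | ⟨t, ht, t', ht', -, rfl⟩)
    · exact (h ρ a ha).1 t ht
    · refine ((h ρ a ha).2 t ht).append ?_
      rintro _ a' ⟨rfl, ha'⟩
      exact (h' ρ a' ha').1 t' ht'
  · rintro _ ⟨t, ht, t', ht', -, rfl⟩
    refine ((h ρ a ha).2 t ht).append ?_
    rintro _ a' ⟨rfl, ha'⟩
    exact (h' ρ a' ha').2 t' ht'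

theorem Valid.par {P₁ P₂ Q₁ Q₂ : Formula Var Perm} (h : Valid Γ P₁ T Q₁)
    (h' : Valid Γ P₂ T' Q₂) : Valid Γ (.star P₁ P₂) (T.par T') (.star Q₁ Q₂) := by
  intro ρ a ha
  obtain ⟨hs, a₁, a₂, rfl, ha₁, ha₂⟩ := holds_star.1 ha
  constructor
  · rintro t ⟨t₁, ht₁, t₂, ht₂, -, -, -, -, hl⟩
    have := Safe.par hl ((h ρ a₁ ha₁).1 t₁ ht₁) ((h' ρ a₂ ha₂).1 t₂ ht₂) (Set.disjoint_empty _) hs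
    rw [Set.union_empty] at this
    exact this.mono fun _ _ _ => trivial
  · rintro t ⟨t₁, ht₁, t₂, ht₂, -, -, -, -, hl⟩
    have := Safe.par hl ((h ρ a₁ ha₁).2 t₁ ht₁) ((h' ρ a₂ ha₂).2 t₂ ht₂) (Set.disjoint_empty _) hs
    rw [Set.union_empty] at this
    refine this.mono ?_
    rintro _ _ ⟨_, _, b₁, b₂, rfl, rfl, hs, ⟨rfl, h₁⟩, rfl, h₂⟩
    exact ⟨Set.union_empty _, holds_star.2 ⟨hs, b₁, b₂, rfl, h₁, h₂⟩⟩

theorem Valid.frame (h : Valid Γ P T Q) : Valid Γ (.star P R) T (.star Q R) := by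
  intro ρ a ha
  obtain ⟨hs, a₁, b, rfl, ha₁, hb⟩ := holds_star.1 ha
  refine ⟨fun t ht => (((h ρ a₁ ha₁).1 t ht).frame hs).mono fun _ _ _ => trivial,
    fun t ht => (((h ρ a₁ ha₁).2 t ht).frame hs).mono ?_⟩
  rintro _ _ ⟨c, rfl, hs, rfl, hc⟩
  exact ⟨rfl, holds_star.2 ⟨hs, c, b, rfl, hc, hb⟩⟩

theorem Valid.conseq (hP : Entails P P') (h : Valid Γ P' T Q') (hQ : Entails Q' Q) :
    Valid Γ P T Q := by
  rintro ρ a ⟨τ, rfl, ha⟩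
  refine ⟨(h ρ _ ⟨τ, rfl, hP ρ τ ha⟩).1,
    fun t ht => ((h ρ _ ⟨τ, rfl, hP ρ τ ha⟩).2 t ht).mono ?_⟩
  rintro _ _ ⟨h, υ, rfl, hυ⟩
  exact ⟨h, υ, rfl, hQ ρ υ hυ⟩

theorem Valid.conj {P₁ P₂ Q₁ Q₂ : Formula Var Perm} (hΓ : ∀ r J, Γ r = some J → Precise J)
    (h₁ : Valid Γ P₁ T Q₁) (h₂ : Valid Γ P₂ T Q₂) : Valid Γ (.and P₁ P₂) T (.and Q₁ Q₂) := by
  rintro ρ a ⟨τ, rfl, ha₁, ha₂⟩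
  refine ⟨(h₁ ρ _ ⟨τ, rfl, ha₁⟩).1, fun t ht =>
    (((h₁ ρ _ ⟨τ, rfl, ha₁⟩).2 t ht).and hΓ ((h₂ ρ _ ⟨τ, rfl, ha₂⟩).2 t ht)).mono ?_⟩
  rintro _ _ ⟨⟨hH, υ, rfl, h⟩, -, h'⟩
  exact ⟨hH, υ, rfl, h, holds_cells.1 h'⟩

variable [DecidableEq Lock] {r : Lock} {J : Formula Var Perm}

theorem Valid.hide (hr : Γ r = none) (h : Valid (Function.update Γ r (some J)) P T Q) :
    Valid Γ (.star P J) (T.hide r) (.star Q J) := by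
  intro ρ a ha
  obtain ⟨hs, a₁, j, rfl, ha₁, hj⟩ := holds_star.1 ha
  have hw : WithInv ρ r J ∅ a₁ (a₁ * j) := .inr ⟨id, j, hj, rfl⟩
  constructor
  · rintro _ ⟨t, ht, ⟨hp, hp'⟩, rfl⟩
    have := ((h ρ a₁ ha₁).1 t ht).hide hr (iff_of_false hp id) hp' hw hs
    rw [Set.empty_sdiff] at this
    exact this.mono fun _ _ _ => trivial
  · rintro _ ⟨t, ht, ⟨hp, hp'⟩, rfl⟩
    have := ((h ρ a₁ ha₁).2 t ht).hide hr (iff_of_false hp id) hp' hw hs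
    rw [Set.empty_sdiff] at this
    refine this.mono ?_
    rintro _ a' ⟨_, b, rfl, hw, hs, rfl, hb⟩
    obtain ⟨hn, -⟩ | ⟨-, j, hj, rfl⟩ := hw
    · exact hn.elim
    · exact ⟨Set.empty_sdiff _, holds_star.2 ⟨hs, b, j, rfl, hb, hj⟩⟩

/-- On acquiring `r`, the Code receives the invariant of `r`. -/
theorem safeStep_acquire {ρ : LVar → ℤ} {B : BExpr Var} (hr : Γ r = none) (hB : EntailsDef P B)
    {a : Resource Var Perm} (ha : Holds ρ P a) {s s' : MState Var Lock}
    (hs : MachineStep (.P r) s s') (hb : B.eval s.mem.stack = some true) :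
    SafeStep (Function.update Γ r (some J)) ρ ⟨s, .P r, s'⟩
      (fun H a => H = {r} ∧ Holds ρ (.and (.star P J) B.formula) a) ∅ a := by
  intro i f σ h1 h2 h3 h4
  obtain ⟨hrs, rfl⟩ : Returns (.P r) s s' := hs.resolve_right fun hf => hf.2.1 r rfl
  obtain ⟨τ, rfl, hP⟩ := ha
  obtain ⟨j, i', rfl, hj, hi'⟩ := (inv_avail_update hr hrs).1 h3
  have h5 : σ.cells = τ.cells * j * i' * f := by rw [h4]; ac_rfl
  have h1 : σ.forget = s.mem := h1
  obtain ⟨υ, hυ⟩ := exists_cells_eq (h5.trans (mul_assoc _ _ _))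
  have hbτ : B.eval τ.forget.stack = some true := by
    rw [← hB.eval_eq hP (h4.trans (mul_assoc _ _ _)), h1, hb]
  have hstar : Sat ρ υ (.star P J) :=
    holds_cells.1 (holds_star.2 ⟨⟨υ, rfl⟩, _, j, hυ, ⟨τ, rfl, hP⟩, hj⟩)
  refine ⟨⟨hrs, rfl⟩, fun q hq => (by cases hq), τ.cells * j, i', ?_, ?_,
    insert_empty_eq _, υ, hυ, hstar,
    (BExpr.sat_formula ρ υ B true (BExpr.eval_of_cells_eq_mul hυ hbτ)).2 rfl⟩
  · rw [Ctx.avail_update_of_mem (Set.mem_insert _ _), Ctx.avail_insert hr]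
    exact hi'
  · rw [← h5, ← h1, LState.lift_forget]

/-- On releasing `r`, the Code gives the invariant of `r` back. -/
theorem safeStep_release {ρ : LVar → ℤ} (hr : Γ r = none) {a : Resource Var Perm}
    (ha : Holds ρ (.star Q J) a) {s s' : MState Var Lock} (hs : MachineStep (.V r) s s') :
    SafeStep (Function.update Γ r (some J)) ρ ⟨s, .V r, s'⟩
      (fun H a => H = ∅ ∧ Holds ρ Q a) {r} a := by
  intro i f σ h1 h2 h3 h4
  have hrs : r ∈ s.locks := h2 rfl
  obtain ⟨-, rfl⟩ : Returns (.V r) s s' := hs.returns ⟨_, hrs, rfl⟩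
  obtain ⟨-, b, j, rfl, hb, hj⟩ := holds_star.1 ha
  rw [Ctx.avail_update_of_mem hrs] at h3
  have h1 : σ.forget = s.mem := h1
  refine ⟨⟨hrs, rfl⟩, fun q hq => (by cases hq; rfl), b, j * i, ?_, ?_, Set.sdiff_self, hb⟩
  · refine (inv_avail_update hr fun h => h.2 rfl).2 ⟨j, i, rfl, hj, ?_⟩
    rw [Ctx.avail_diff hr]
    exact h3
  · rw [← h1, LState.lift_forget, h4]
    ac_rfl

theorem Valid.inside {B : BExpr Var} (hr : Γ r = none) (hB : EntailsDef P B)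
    (h : Valid Γ (.and (.star P J) B.formula) T (.star Q J)) :
    Valid (Function.update Γ r (some J)) P (.whenB B true (.inside r T)) Q := by
  intro ρ a ha
  have acquire : ∀ t : Trace Var Lock, ∀ s s' l, t.steps = ⟨s, .P r, s'⟩ :: l →
      B.eval t.codeSrc.mem.stack = some true →
      SafeStep (Function.update Γ r (some J)) ρ ⟨s, .P r, s'⟩
        (fun H a => H = {r} ∧ Holds ρ (.and (.star P J) B.formula) a) ∅ a := by
    intro t s s' l ht hb
    rw [Trace.codeSrc_of_steps_eq ht] at hb
    exact safeStep_acquire hr hB ha (t.valid ⟨s, .P r, s'⟩ (by simp [ht])) hb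
  have body : ∀ b, Holds ρ (.and (.star P J) B.formula) b → ∀ t ∈ T.traces,
      Safe (Function.update Γ r (some J)) ρ (fun _ _ => True) t.steps {r} b := by
    intro b hb t ht
    have := ((h ρ b hb).1 t ht).critical (r := r) (J := J) id
    rw [insert_empty_eq] at this
    exact this.mono fun _ _ _ => trivial
  have body_ret : ∀ b, Holds ρ (.and (.star P J) B.formula) b → ∀ t ∈ T.ret,
      Safe (Function.update Γ r (some J)) ρ (fun H a => H = {r} ∧ Holds ρ (.star Q J) a)
        t.steps {r} b := by
    intro b hb t ht
    have := ((h ρ b hb).2 t ht).critical (r := r) (J := J) id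
    rw [insert_empty_eq] at this
    refine this.mono ?_
    rintro _ _ ⟨_, rfl, rfl, h⟩
    exact ⟨insert_empty_eq _, h⟩
  constructor
  · rintro t ⟨(ht | ⟨t₁, ⟨s, s', ht₁, -⟩, t₂, ht₂, -, rfl⟩) |
      ⟨_, ⟨t₁, ⟨s, s', ht₁, -⟩, t₂, ht₂, -, rfl⟩, t₃, ht₃, -, rfl⟩, hb⟩
    · rcases ht with ht | ⟨s, s', ht⟩
      · rw [ht]
        trivial
      · have := acquire t s s' _ ht hb
        rw [ht]
        exact this.mono fun _ _ _ => trivial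
    · have ht : (t₁.comp t₂).steps = ⟨s, .P r, s'⟩ :: t₂.steps := by simp [Trace.comp, ht₁]
      have := acquire _ s s' _ ht hb
      rw [ht]
      refine this.mono ?_
      rintro _ b ⟨rfl, hb⟩
      exact body b hb t₂ ht₂
    · have ht : ((t₁.comp t₂).comp t₃).steps = ⟨s, .P r, s'⟩ :: (t₂.steps ++ t₃.steps) := by
        simp [Trace.comp, ht₁]
      have := acquire _ s s' _ ht hb
      rw [ht]
      refine this.mono ?_
      rintro _ b ⟨rfl, hb⟩
      refine (body_ret b hb t₂ ht₂).append ?_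
      rintro _ b ⟨rfl, hb⟩
      rcases ht₃ with ht₃ | ⟨s, s', ht₃⟩
      · rw [ht₃]
        trivial
      · have hv := t₃.valid ⟨s, .V r, s'⟩ (by simp [ht₃])
        rw [ht₃]
        exact (safeStep_release hr hb hv).mono fun _ _ _ => trivial
  · rintro t ⟨⟨_, ⟨t₁, ⟨s, s', ht₁, -⟩, t₂, ht₂, -, rfl⟩, t₃, ⟨u, u', ht₃, -⟩, -, rfl⟩, hb⟩
    have ht : ((t₁.comp t₂).comp t₃).steps = ⟨s, .P r, s'⟩ :: (t₂.steps ++ t₃.steps) := by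
      simp [Trace.comp, ht₁]
    have := acquire _ s s' _ ht hb
    rw [ht]
    refine this.mono ?_
    rintro _ b ⟨rfl, hb⟩
    refine (body_ret b hb t₂ ht₂).append ?_
    rintro _ b ⟨rfl, hb⟩
    have hv := t₃.valid ⟨u, .V r, u'⟩ (by simp [ht₃])
    rw [ht₃]
    exact safeStep_release hr hb hv

omit [DecidableEq Lock] in
theorem Valid.test_true {B : BExpr Var} (hB : EntailsDef P B) :
    Valid Γ P (.whenB B true (.ofInstr .nop)) (.and P B.formula) :=
  .test hB fun ρ σ hP hb => ⟨hP, (BExpr.sat_formula ρ σ B true hb).2 rfl⟩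

omit [DecidableEq Lock] in
theorem Valid.test_false {B : BExpr Var} (hB : EntailsDef P B) :
    Valid Γ P (.whenB B false (.ofInstr .nop)) (.and P (.not B.formula)) :=
  .test hB fun ρ σ hP hb => ⟨hP, fun h =>
    Bool.false_ne_true ((BExpr.sat_formula ρ σ B false hb).1 h)⟩

omit [DecidableEq Lock] in
theorem Valid.loop {B : BExpr Var} (hB : EntailsDef P B) (h : Valid Γ (.and P B.formula) T P) :
    Valid Γ P (.iUnion fun n : ℕ =>
      (fun U => ((((TransSys.whenB B true (.ofInstr .nop)).seq T).seq U).union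
        (.whenB B false (.ofInstr .nop))).union (.whenAbort B))^[n] .empty)
      (.and P (.not B.formula)) := by
  refine Valid.iUnion fun n => ?_
  induction n with
  | zero => exact .empty
  | succ n ih =>
    rw [Function.iterate_succ_apply']
    exact ((((Valid.test_true hB).seq h).seq ih).union (.test_false hB)).union (.whenAbort hB)

/-! ### Soundness -/

/-- Derivable triples are valid. -/
theorem Derivable.valid {C : Cmd Var Lock} (h : Derivable Γ P C Q) : Valid Γ P C.sem Q := by
  induction h with
  | aff Γ x E X => exact (localSpec_assign x E X).valid (by simp) (by simp)
  | store Γ E E' => exact (localSpec_store E E').valid (by simp) (by simp)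
  | load Γ x E p v _ => exact (localSpec_load x E p v).valid (by simp) (by simp)
  | alloc Γ x E X => exact (localSpec_alloc x E X).valid (by simp) (by simp)
  | dispose Γ E => exact (localSpec_dispose E).valid (by simp) (by simp)
  | skip Γ P => exact (localSpec_nop P).valid (by simp) (by simp)
  | seq _ _ ih ih' => exact ih.seq ih'
  | ite hB _ _ ih ih' =>
    exact (((Valid.test_true hB).seq ih).union ((Valid.test_false hB).seq ih')).union
      (.whenAbort hB)
  | conj hΓ _ _ ih ih' => exact ih.conj hΓ ih'
  | res hr _ ih => exact ih.hide hr
  | withWhen hr hB _ ih => exact (ih.inside hr hB).union (.whenAbort hB)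
  | par _ _ ih ih' => exact ih.par ih'
  | frame R _ ih => exact ih.frame
  | conseq hP _ hQ ih => exact ih.conseq hP hQ
  -- The remaining rule is the one for loops, whose name is a keyword.
  | _ =>
    rename_i hB _ ih
    exact ih.loop hB

omit [DecidableEq Lock] in
/-- A safe execution in which the Environment is passive runs without error and preserves the
frame. -/
theorem Safe.run {ρ : LVar → ℤ} {S : Set Lock → Resource Var Perm → Prop}
    {l : List (CodeStep Var Lock)} {H : Set Lock} {a f : Resource Var Perm}
    (h : Safe Ctx.empty ρ S l H a) {s t : MState Var Lock}
    (hp : ∀ e ∈ (s :: l.map CodeStep.tgt).zip (l.map CodeStep.src ++ [t]), e.1 = e.2)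
    {σ : LState Var Perm} (hs : σ.forget = s.mem) (hH : H ⊆ s.locks) (hσ : σ.cells = a * f) :
    (∀ c ∈ l, Returns c.instr c.src c.tgt) ∧
      ∃ H' a', S H' a' ∧ ∃ σ' : LState Var Perm, σ'.forget = t.mem ∧ σ'.cells = a' * f := by
  have hav : ∀ L : Set Lock, Ctx.avail (Ctx.empty : Ctx Var Lock Perm) L = Ctx.empty := fun L => by
    funext r
    exact ite_self _
  induction l generalizing H a s σ with
  | nil =>
    obtain rfl : s = t := hp (s, t) (.head _)
    exact ⟨by simp, H, a, h, σ, hs, hσ⟩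
  | cons c l ih =>
    simp only [List.map_cons, List.cons_append, List.zip_cons_cons, List.forall_mem_cons] at hp
    obtain ⟨rfl, hp⟩ := hp
    obtain ⟨h1, h2, a', i, h3, h4, h5⟩ := h 1 f σ hs hH (by rw [hav, inv_empty_iff])
      (by rw [hσ, mul_one])
    rw [hav, inv_empty_iff] at h3
    rw [h3, mul_one] at h4
    have hH' : c.instr.held H ⊆ c.tgt.locks := by
      rw [h1.locks_eq]
      cases c.instr <;> simp only [Instr.held] <;> try exact hH
      · exact Set.insert_subset_insert hH
      · exact Set.sdiff_subset_sdiff_left hH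
    obtain ⟨h6, h7⟩ := ih h5 hp (σ.forget_lift _) hH' h4
    exact ⟨List.forall_mem_cons.2 ⟨h1, h6⟩, h7⟩

end

end CSL

theorem corollary1 {Var Lock Perm : Type*} [DecidableEq Var] [DecidableEq Lock]
    [CSL.PermMonoid Perm]
    (P Q : CSL.Formula Var Perm) (C : CSL.Cmd Var Lock)
    (hder : CSL.Derivable CSL.Ctx.empty P C Q)
    (ρ : CSL.LVar → ℤ) (t : CSL.Trace Var Lock)
    (ht : t ∈ C.sem.traces) (hpassive : t.Passive)
    (hsat : t.src.Satisfies ρ (.star P .tru)) :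
    (∀ c ∈ t.steps, CSL.Returns c.instr c.src c.tgt) ∧
      (t ∈ C.sem.ret → t.tgt.Satisfies ρ (.star Q .tru)) := by
  obtain ⟨σ, hσ, τ, φ, hsep, hP, -⟩ := hsat
  have hcells := (CSL.isSep_iff _ _ _).1 hsep
  have hvalid := hder.valid ρ τ.cells ⟨τ, rfl, hP⟩
  refine ⟨((hvalid.1 t ht).run hpassive hσ (Set.empty_subset _) hcells).1, fun hret => ?_⟩
  obtain ⟨-, _, _, ⟨-, υ, rfl, hQ⟩, σ', hσ', hcells'⟩ :=
    (hvalid.2 t hret).run hpassive hσ (Set.empty_subset _) hcells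
  exact ⟨σ', hσ', υ, φ, (CSL.isSep_iff _ _ _).2 hcells', hQ, trivial⟩
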